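/- **Network.** A typical user sits at the origin of $\mathbb R^2$. Terrestrial base stations (TBSs) form a homogeneous Poisson point process $\Phi_T$ of density $\lambda_T>0$ on the ground. Aerial base stations (ABSs) hover at height $h>0$; the horizontal positions of the line-of-sight (LoS) and of the non-line-of-sight (NLoS) ones form Poisson point processes $\Phi_L,\Phi_N$ with intensities $\lambda_A P_L(|x|)\,dx$ and $\lambda_A P_N(|x|)\,dx$, where $\lambda_A>0$, $P_N=1-P_L$ and, for $x>0$, $$P_L(x)=\frac1{1+a\exp\left(-b\left(\frac{180}{\pi}\arctan\left(\frac hx-c\right)-d\right)\right)},\qquad a,b>0,\ c,d\in\mathbb R$$ (the usual S-curve is $c=0,d=a$). The processes $\Phi_T,\Phi_L,\Phi_N$ are independent. Let $\alpha_L,\alpha_N,\alpha_T$, $C_L,C_N,C_T$, $m_L,m_N$, $P_A,P_T,G_M,R_B,\sigma_A^2>0$, $R_f\ge h$, $0\le\beta<1$, $a_m>a_n>0$ with $a_m+a_n=1$, and let $\epsilon_f,\epsilon_t>0$ be the target SINRs. The link to the $i$-th LoS (NLoS) ABS has length $R_{L,i}$ ($R_{N,i}$), the square root of $h^2$ plus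 the squared horizontal distance, and channel gain $H_{L,i}\sim\Gamma(m_L,1/m_L)$ ($H_{N,i}\sim\Gamma(m_N,1/m_N)$; shape and scale). All gains are independent of each other and of the positions. Let $R_{L,0},R_{N,0},R_{T,0}$ be the distances from the user to the nearest LoS ABS, NLoS ABS and TBS. **Association.** Put $\eta_L=a_nP_AC_L$, $\eta_N=a_nP_AC_N$, $\eta_T=G_MP_TC_T$. Let $B_L$ be the event that the user is associated with a LoS ABS, i.e. that $\eta_LR_{L,0}^{-\alpha_L}$ exceeds both $\eta_NR_{N,0}^{-\alpha_N}$ and $\eta_TR_{T,0}^{-\alpha_T}\mathbf 1(R_{T,0}\le R_B)$, and let $A_L=\mathbb P(B_L)$. **Coverage.** For a serving LoS ABS at distance $r$ with gain $H$ and total interference $I$ from the other ABSs, put $S=P_AC_Lr^{-\alpha_L}H$. If $r\le R_f$ (near case), the user is covered when $$\frac{a_mS}{a_nS+I+\sigma_A^2}>\epsilon_f\quad\text{and}\quad\frac{a_nS}{I+\sigma_A^2+\beta a_mS}>\epsilon_t .$$ If $r>R_f$ (far case), it is covered when $\frac{a_mS}{a_nS+I+\sigma_A^2}>\epsilon_t$.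 Let $P_{cov,LoS}(\epsilon_f,\epsilon_t)$ be the conditional probability, given $B_L$, that the user is covered when served by its nearest LoS ABS, where $I$ is the sum of $P_AC_LR_{L,i}^{-\alpha_L}H_{L,i}$ over all LoS ABSs except the serving one and of $P_AC_NR_{N,i}^{-\alpha_N}H_{N,i}$ over all NLoS ABSs. **Ingredients of the formula.** Put $l_{L,h}=(\eta_L/\eta_N)^{1/\alpha_L}h^{\alpha_N/\alpha_L}$, $l_{L,T}=(\eta_L/\eta_T)^{1/\alpha_L}R_B^{\alpha_T/\alpha_L}$, $\tau_{T|L}(r)=(\eta_T/\eta_L)^{1/\alpha_T}r^{\alpha_L/\alpha_T}$, and $\tau_{N|L}(r)=h$ if $r\le l_{L,h}$, $\tau_{N|L}(r)=(\eta_N/\eta_L)^{1/\alpha_N}r^{\alpha_L/\alpha_N}$ if $r>l_{L,h}$. For $r\ge h$, let $P_{cov,near|LoS}(r)$ and $P_{cov,far|LoS}(r)$ be the probabilities that the above near condition, respectively far condition, holds when $H\sim\Gamma(m_L,1/m_L)$ is independent of $I$, and $I$ is the sum of the interference terms over the LoS ABSs at distance greater than $r$ and the NLoS ABSs at distance greater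 than $\tau_{N|L}(r)$. Let $Q_T=1-e^{-\pi\lambda_TR_B^2}$ and, for $r\ge h$, $$f_{R_{L,0}}(r)=2\pi\lambda_ArP_L\left(\sqrt{r^2-h^2}\right)\exp\left(-2\pi\lambda_A\int_0^{\sqrt{r^2-h^2}}xP_L(x)\,dx\right),$$ $$v(r)=\exp\left(-2\pi\lambda_A\int_0^{\sqrt{\tau_{N|L}(r)^2-h^2}}xP_N(x)\,dx\right).$$ The densities of the serving distance in the cases without and with a TBS within distance $R_B$ of the user are $$f_{\hat R_{L,0},1}(r)=\frac{f_{R_{L,0}}(r)}{A_L}(1-Q_T)\begin{cases}1,&h\le r\le l_{L,h}\\ v(r),&r\ge h,\ r>l_{L,h},\end{cases}$$ $$f_{\hat R_{L,0},2}(r)=\frac{f_{R_{L,0}}(r)}{A_L}\left[e^{-\pi\lambda_T\tau_{T|L}(r)^2}-(1-Q_T)\right]\begin{cases}1,&h\le r\le l_{L,T},\ (l_{L,T}<l_{L,h}\text{ or }r\le l_{L,h})\\ v(r),&h\le r\le l_{L,T},\ l_{L,h}<r,\ l_{L,h}\le l_{L,T},\end{cases}$$ and $0$ elsewhere. **Theorem.**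 $A_L>0$, the integrals below converge absolutely, and $$P_{cov,LoS}(\epsilon_f,\epsilon_t)=\sum_{i=1}^2\left[\int_h^{R_f}P_{cov,near|LoS}(r)\,f_{\hat R_{L,0},i}(r)\,dr+\int_{R_f}^\infty P_{cov,far|LoS}(r)\,f_{\hat R_{L,0},i}(r)\,dr\right].$$ -/

import Mathlib

open MeasureTheory ProbabilityTheory Set
open scoped ENNReal NNReal

noncomputable section

namespace UAVNet

/-- The horizontal plane; the typical user sits at the origin. -/
abbrev Plane : Type := EuclideanSpace ℝ (Fin 2)

/-! ### Poisson point processes -/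

/-- The number of points of the sequence `X 0 ω, X 1 ω, …` that lie in `B`, with multiplicity. -/
def pointCount {Ω : Type*} (X : ℕ → Ω → Plane) (B : Set Plane) (ω : Ω) : ℕ∞ :=
  {i : ℕ | X i ω ∈ B}.encard

/-- The random points `X 0, X 1, …` form (an enumeration of) a Poisson point process with
intensity measure `μ`: the number of points in a set of finite intensity is Poisson distributed
with mean `μ B`, and the numbers of points in disjoint sets are independent. A process of infinite
total intensity, which is the only case needed here, almost surely has infinitely many points. -/
structure IsPoissonProcess {Ω : Type*} [MeasurableSpace Ω] (P : Measure Ω)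
    (X : ℕ → Ω → Plane) (μ : Measure Plane) : Prop where
  measurable : ∀ i, Measurable (X i)
  law : ∀ B : Set Plane, MeasurableSet B → μ B < ∞ →
    P.map (pointCount X B) = (poissonMeasure (μ B).toNNReal).map (fun n : ℕ => (n : ℕ∞))
  indep : ∀ (n : ℕ) (B : Fin n → Set Plane), (∀ k, MeasurableSet (B k)) → (∀ k, μ (B k) < ∞) →
    Pairwise (fun k l => Disjoint (B k) (B l)) → iIndepFun (fun k => pointCount X (B k)) P

/-! ### Parameters -/

/-- The deterministic parameters of the network, with their standing constraints. -/
structure Params where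
  /-- Density of the terrestrial base stations (TBSs). -/
  lamT : ℝ
  /-- Density of the aerial base stations (ABSs). -/
  lamA : ℝ
  /-- Height of the ABSs. -/
  h : ℝ
  /-- Radius of the line-of-sight ball of the TBSs. -/
  RB : ℝ
  /-- Distance between an ABS and the fixed user that it serves. -/
  Rf : ℝ
  /-- S-curve parameters `a`, `b`. -/
  a : ℝ
  b : ℝ
  /-- Offsets of the S-curve: `c` is subtracted from `h / x`, `d` from the angle in degrees. -/
  c : ℝ
  d : ℝ
  /-- Path loss exponents. -/
  alL : ℝ
  alN : ℝ
  alT : ℝ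
  /-- Additive losses. -/
  CL : ℝ
  CN : ℝ
  CT : ℝ
  /-- Nakagami fading parameters of the LoS and NLoS links. -/
  mL : ℝ
  mN : ℝ
  /-- Transmit powers. -/
  PT : ℝ
  PA : ℝ
  /-- Main-lobe gain of the TBSs. -/
  GM : ℝ
  /-- Power fractions of the far user (`am`) and of the near user (`an`). -/
  am : ℝ
  an : ℝ
  /-- Coefficient of imperfect successive interference cancellation. -/
  beta : ℝ
  /-- Noise power of the ABS tier. -/
  sigSqA : ℝ
  lamT_pos : 0 < lamT
  lamA_pos : 0 < lamA
  h_pos : 0 < h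
  RB_pos : 0 < RB
  h_le_Rf : h ≤ Rf
  a_pos : 0 < a
  b_pos : 0 < b
  alL_pos : 0 < alL
  alN_pos : 0 < alN
  alT_pos : 0 < alT
  CL_pos : 0 < CL
  CN_pos : 0 < CN
  CT_pos : 0 < CT
  mL_pos : 0 < mL
  mN_pos : 0 < mN
  PT_pos : 0 < PT
  PA_pos : 0 < PA
  GM_pos : 0 < GM
  an_pos : 0 < an
  an_lt_am : an < am
  am_add_an : am + an = 1
  beta_nonneg : 0 ≤ beta
  beta_lt_one : beta < 1
  sigSqA_pos : 0 < sigSqA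

namespace Params

variable (p : Params)

/-- The S-curve: probability that a link of horizontal length `x` is line-of-sight. Directly
below the base station, at `x = 0`, the arctangent takes its limit value `π / 2`. -/
def probL (x : ℝ) : ℝ :=
  1 / (1 + p.a * Real.exp (-p.b *
    (180 / Real.pi * (if x = 0 then Real.pi / 2 else Real.arctan (p.h / x - p.c)) - p.d)))

/-- Probability that a link of horizontal length `x` is non-line-of-sight. -/
def probN (x : ℝ) : ℝ := 1 - p.probL x

/-- Intensity measure of the horizontal positions of the LoS ABSs. -/
def intensityL : Measure Plane :=
  volume.withDensity (fun x => ENNReal.ofReal (p.lamA * p.probL ‖x‖))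

/-- Intensity measure of the horizontal positions of the NLoS ABSs. -/
def intensityN : Measure Plane :=
  volume.withDensity (fun x => ENNReal.ofReal (p.lamA * p.probN ‖x‖))

/-- Intensity measure of the positions of the TBSs. -/
def intensityT : Measure Plane :=
  volume.withDensity (fun _ => ENNReal.ofReal p.lamT)

/-- Distance between the typical user and an ABS with horizontal position `x`. -/
def dist3 (x : Plane) : ℝ := Real.sqrt (‖x‖ ^ 2 + p.h ^ 2)

def etaL : ℝ := p.an * p.PA * p.CL

def etaN : ℝ := p.an * p.PA * p.CN

def etaT : ℝ := p.GM * p.PT * p.CT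

/-- Average received power from a LoS ABS at distance `r`. -/
def powL (r : ℝ) : ℝ := p.etaL * r ^ (-p.alL)

/-- Average received power from a NLoS ABS at distance `r`. -/
def powN (r : ℝ) : ℝ := p.etaN * r ^ (-p.alN)

/-- Average received power from a TBS at distance `r`; it is blocked outside the LoS ball. -/
def powT (r : ℝ) : ℝ := if r ≤ p.RB then p.etaT * r ^ (-p.alT) else 0

/-! ### The signal-to-interference-plus-noise ratios

`r` is the distance to the serving LoS ABS, `g` the channel gain of the serving link and `I` the
total interference from the other ABSs, which may be infinite. -/

/-- Power received over a LoS link of length `r` with channel gain `g` from a transmission with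
the fraction `q` of the total power. -/
def rxL (q r g : ℝ) : ℝ≥0∞ := ENNReal.ofReal (q * p.PA * p.CL * r ^ (-p.alL) * g)

/-- Power received over a NLoS link of length `r` with channel gain `g` at full power. -/
def rxN (r g : ℝ) : ℝ≥0∞ := ENNReal.ofReal (p.PA * p.CN * r ^ (-p.alN) * g)

/-- The typical user, being the near user, decodes the message of the fixed user. -/
def sinrNearFixed (r g : ℝ) (I : ℝ≥0∞) : ℝ≥0∞ :=
  p.rxL p.am r g / (p.rxL p.an r g + I + ENNReal.ofReal p.sigSqA)

/-- The typical user, being the near user, decodes its own message after interference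
cancellation. -/
def sinrNearOwn (r g : ℝ) (I : ℝ≥0∞) : ℝ≥0∞ :=
  p.rxL p.an r g / (I + ENNReal.ofReal p.sigSqA + p.rxL (p.beta * p.am) r g)

/-- The typical user, being the far user, decodes its own message. -/
def sinrFar (r g : ℝ) (I : ℝ≥0∞) : ℝ≥0∞ :=
  p.rxL p.am r g / (p.rxL p.an r g + I + ENNReal.ofReal p.sigSqA)

/-- Successful decoding in the near case, for the thresholds `ef` (fixed user) and `et`
(typical user). -/
def NearSuccess (ef et r g : ℝ) (I : ℝ≥0∞) : Prop :=
  ENNReal.ofReal ef < p.sinrNearFixed r g I ∧ ENNReal.ofReal et < p.sinrNearOwn r g I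

/-- Successful decoding in the far case. -/
def FarSuccess (et r g : ℝ) (I : ℝ≥0∞) : Prop :=
  ENNReal.ofReal et < p.sinrFar r g I

/-! ### Critical distances and the unconditional distance density -/

/-- Distance at which a LoS ABS is received as strongly as a NLoS ABS at the distance `h`. -/
def lLh : ℝ := (p.etaL / p.etaN) ^ (1 / p.alL) * p.h ^ (p.alN / p.alL)

/-- Distance at which a LoS ABS is received as strongly as a TBS at the distance `RB`. -/
def lLT : ℝ := (p.etaL / p.etaT) ^ (1 / p.alL) * p.RB ^ (p.alT / p.alL)

/-- Minimum distance of an interfering TBS when the serving LoS ABS is at the distance `r`. -/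
def tauT (r : ℝ) : ℝ := (p.etaT / p.etaL) ^ (1 / p.alT) * r ^ (p.alL / p.alT)

/-- Minimum distance of an interfering NLoS ABS when the serving LoS ABS is at the
distance `r`. -/
def tauN (r : ℝ) : ℝ :=
  if r ≤ p.lLh then p.h else (p.etaN / p.etaL) ^ (1 / p.alN) * r ^ (p.alL / p.alN)

/-- Probability that there is a TBS in the LoS ball. -/
def QT : ℝ := 1 - Real.exp (-Real.pi * p.lamT * p.RB ^ 2)

/-- Density, on `[h, ∞)`, of the distance to the nearest LoS ABS. -/
def densL (r : ℝ) : ℝ :=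
  2 * Real.pi * p.lamA * r * p.probL (Real.sqrt (r ^ 2 - p.h ^ 2)) *
    Real.exp (-2 * Real.pi * p.lamA *
      ∫ x in (0 : ℝ)..Real.sqrt (r ^ 2 - p.h ^ 2), x * p.probL x)

/-- Probability that no NLoS ABS is closer than `tauN r`. -/
def voidN (r : ℝ) : ℝ :=
  Real.exp (-2 * Real.pi * p.lamA *
    ∫ x in (0 : ℝ)..Real.sqrt (p.tauN r ^ 2 - p.h ^ 2), x * p.probN x)

end Params

/-! ### The random network -/

/-- The random network: horizontal positions of the LoS ABSs, of the NLoS ABSs and of the TBSs,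
and the channel gains of the LoS and of the NLoS links to the typical user. -/
structure Network (p : Params) {Ω : Type*} [MeasurableSpace Ω] (P : Measure Ω) where
  XL : ℕ → Ω → Plane
  XN : ℕ → Ω → Plane
  XT : ℕ → Ω → Plane
  HL : ℕ → Ω → ℝ
  HN : ℕ → Ω → ℝ
  poissonL : IsPoissonProcess P XL p.intensityL
  poissonN : IsPoissonProcess P XN p.intensityN
  poissonT : IsPoissonProcess P XT p.intensityT
  measurable_HL : ∀ i, Measurable (HL i)
  measurable_HN : ∀ i, Measurable (HN i)
  /-- Gamma distribution of shape `m` and scale `1 / m`, that is, rate `m`. -/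
  law_HL : ∀ i, P.map (HL i) = gammaMeasure p.mL p.mL
  law_HN : ∀ i, P.map (HN i) = gammaMeasure p.mN p.mN
  /-- The three point processes are independent. -/
  indep_positions : iIndepFun (fun (k : Fin 3) (ω : Ω) (i : ℕ) => ![XL, XN, XT] k i ω) P
  /-- All channel gains are independent. -/
  indep_gains : iIndepFun (fun k : ℕ ⊕ ℕ => Sum.elim HL HN k) P
  /-- The channel gains are independent of the positions. -/
  indep_positions_gains : IndepFun
    (fun ω => (fun i => XL i ω, fun i => XN i ω, fun i => XT i ω))
    (fun ω => (fun i => HL i ω, fun i => HN i ω)) P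

namespace Network

variable {p : Params} {Ω : Type*} [MeasurableSpace Ω] {P : Measure Ω} (M : Network p P)

/-- Distance to the nearest LoS ABS. -/
def RL (ω : Ω) : ℝ := ⨅ i, p.dist3 (M.XL i ω)

/-- Distance to the nearest NLoS ABS. -/
def RN (ω : Ω) : ℝ := ⨅ i, p.dist3 (M.XN i ω)

/-- Distance to the nearest TBS. -/
def RT (ω : Ω) : ℝ := ⨅ i, ‖M.XT i ω‖

/-- The event that the typical user is associated with a LoS ABS: the average received power
from the nearest LoS ABS exceeds those from the nearest NLoS ABS and from the nearest TBS. -/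
def assocL : Set Ω := {ω | p.powN (M.RN ω) < p.powL (M.RL ω) ∧ p.powT (M.RT ω) < p.powL (M.RL ω)}

/-- Probability of association with a LoS ABS. -/
def probAssocL : ℝ := P.real M.assocL

/-- Interference from all ABSs other than the `j`-th LoS one. -/
def interference (j : ℕ) (ω : Ω) : ℝ≥0∞ :=
  (∑' i : ℕ, if i = j then 0 else p.rxL 1 (p.dist3 (M.XL i ω)) (M.HL i ω)) +
    ∑' i : ℕ, p.rxN (p.dist3 (M.XN i ω)) (M.HN i ω)

/-- The event of successful decoding when the typical user is served by its nearest LoS ABS: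
this ABS has the index `j`, and decoding succeeds in the near or in the far case, according to
its distance. -/
def success (ef et : ℝ) : Set Ω :=
  {ω | ∃ j, p.dist3 (M.XL j ω) = M.RL ω ∧
    ((M.RL ω ≤ p.Rf ∧ p.NearSuccess ef et (M.RL ω) (M.HL j ω) (M.interference j ω)) ∨
      (p.Rf < M.RL ω ∧ p.FarSuccess et (M.RL ω) (M.HL j ω) (M.interference j ω)))}

/-- Coverage probability of a typical user that is associated with a LoS ABS. -/
def covL (ef et : ℝ) : ℝ := (ProbabilityTheory.cond P M.assocL).real (M.success ef et)

/-! ### Coverage at a given serving distance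

The serving link has a channel gain that is independent of the interference; the interfering LoS
ABSs are farther than `r`, and the interfering NLoS ABSs are farther than `tauN r`. -/

/-- Interference when the serving LoS ABS is at the distance `r`. -/
def interferenceAt (r : ℝ) (ω : Ω) : ℝ≥0∞ :=
  (∑' i : ℕ, if r < p.dist3 (M.XL i ω) then p.rxL 1 (p.dist3 (M.XL i ω)) (M.HL i ω) else 0) +
    ∑' i : ℕ, if p.tauN r < p.dist3 (M.XN i ω) then p.rxN (p.dist3 (M.XN i ω)) (M.HN i ω) else 0

/-- Coverage probability in the near case with serving distance `r`. -/
def covNear (ef et r : ℝ) : ℝ :=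
  ((gammaMeasure p.mL p.mL).prod P).real
    {x : ℝ × Ω | p.NearSuccess ef et r x.1 (M.interferenceAt r x.2)}

/-- Coverage probability in the far case with serving distance `r`. -/
def covFar (et r : ℝ) : ℝ :=
  ((gammaMeasure p.mL p.mL).prod P).real
    {x : ℝ × Ω | p.FarSuccess et r x.1 (M.interferenceAt r x.2)}

/-! ### Densities of the serving distance -/

/-- Density of the serving distance, for the case that there is no TBS in the LoS ball. -/
def servDens1 (r : ℝ) : ℝ :=
  if r < p.h then 0
  else if r ≤ p.lLh then p.densL r / M.probAssocL * (1 - p.QT)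
  else p.densL r / M.probAssocL * p.voidN r * (1 - p.QT)

/-- Density of the serving distance, for the case that there is a TBS in the LoS ball. -/
def servDens2 (r : ℝ) : ℝ :=
  if r < p.h ∨ p.lLT < r then 0
  else if p.lLT < p.lLh ∨ r ≤ p.lLh then
    p.densL r / M.probAssocL * (Real.exp (-Real.pi * p.lamT * p.tauT r ^ 2) - (1 - p.QT))
  else
    p.densL r / M.probAssocL * (Real.exp (-Real.pi * p.lamT * p.tauT r ^ 2) - (1 - p.QT)) *
      p.voidN r

/-- The two (sub-probability) densities: index `0` without, index `1` with a TBS in the ball. -/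
def servDens (i : Fin 2) (r : ℝ) : ℝ := ![M.servDens1, M.servDens2] i r

end Network

end UAVNet

end

/-! Coverage depends only on three quantities: the serving distance R, the gain H of the serving
link and the interference I. The theorem follows once their joint law on the association event is
known (`Network.map_link_eq`): R has the density `assocDens`, that is, `densL` times the probability
`voidN` that no NLoS ABS is stronger, times the probability `voidT` that no TBS is stronger. Given R
= r, the gain is an independent Gamma variable and I is distributed as `interferenceAt r`.

Both sides of this identity are compared through the Laplace transform in I at the natural numbers
n. These values suffice, because polynomials in exp(-x) separate the points of [0, ∞]
(`measure_ext_of_lintegral_expNeg`). The transform is computed by successive integration.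

Gains: with the positions frozen, the gains are independent. Each interferer at distance t then
contributes a deterministic weight F(t), the negative logarithm of a one-link Laplace transform, and
the serving gain splits off as a factor (`lintegral_gains_serving`).

NLoS ABSs and TBSs: given R = r, association says that the nearest NLoS ABS is farther than `tauN r`
and the nearest TBS farther than `min RB (tauT r)`. Both are void events of independent Poisson
processes.

LoS ABSs: the Laplace functional E exp(-∑ F) = exp(-∫ (1 - exp(-F)) dμ) also covers the event that
the nearest point is farther than r, by giving the closer points infinite weight. Differentiation in
r yields the joint law of the nearest distance and the sum, and division by exp(-F(R)) removes the
nearest point from the sum (`IsPoissonProcess.lintegral_nearest`).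

The same Laplace functional evaluates the transform of `interferenceAt r`, and the two sides agree.
Finally, the two densities of the statement add up to `assocDens` divided by the association
probability (`servDens_add`), and almost surely no two LoS ABSs are equally far, so the serving
index is unambiguous. -/

namespace UAVNet

open Filter Topology

/-! ### The exponential exp(-x) on [0, ∞] -/

/-- The function `x ↦ exp (-x)` on `[0, ∞]`. -/
noncomputable def expNeg (x : ℝ≥0∞) : ℝ≥0∞ := EReal.exp (-(x : EReal))

/-- The inverse of `expNeg` on `[0, 1]`. -/
noncomputable def negLog (u : ℝ≥0∞) : ℝ≥0∞ := (-(ENNReal.log u)).toENNReal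

@[simp] lemma expNeg_zero : expNeg 0 = 1 := by simp [expNeg]

@[simp] lemma expNeg_top : expNeg ⊤ = 0 := by simp [expNeg]

lemma expNeg_add (x y : ℝ≥0∞) : expNeg (x + y) = expNeg x * expNeg y := by
  unfold expNeg
  rw [← EReal.exp_add, EReal.coe_ennreal_add, EReal.neg_add, sub_eq_add_neg]
  · exact Or.inl (EReal.coe_ennreal_ne_bot x)
  · exact Or.inr (EReal.coe_ennreal_ne_bot y)

lemma continuous_expNeg : Continuous expNeg :=
  ENNReal.continuous_exp.comp (continuous_neg.comp continuous_coe_ennreal_ereal)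

lemma measurable_expNeg : Measurable expNeg := continuous_expNeg.measurable

lemma expNeg_anti : Antitone expNeg := fun _ _ h =>
  EReal.exp_monotone (EReal.neg_le_neg_iff.2 (EReal.coe_ennreal_le_coe_ennreal_iff.2 h))

lemma expNeg_le_one (x : ℝ≥0∞) : expNeg x ≤ 1 := expNeg_zero ▸ expNeg_anti zero_le

lemma expNeg_ne_top (x : ℝ≥0∞) : expNeg x ≠ ⊤ := ((expNeg_le_one x).trans_lt ENNReal.one_lt_top).ne

lemma expNeg_eq_zero_iff {x : ℝ≥0∞} : expNeg x = 0 ↔ x = ⊤ := by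
  simp [expNeg, EReal.neg_eq_bot_iff]

lemma expNeg_ofReal {x : ℝ} (hx : 0 ≤ x) :
    expNeg (ENNReal.ofReal x) = ENNReal.ofReal (Real.exp (-x)) := by
  rw [expNeg, EReal.coe_ennreal_ofReal, max_eq_left hx, ← EReal.coe_neg, EReal.exp_coe]

lemma negLog_expNeg (x : ℝ≥0∞) : negLog (expNeg x) = x := by
  simp [negLog, expNeg]

lemma expNeg_negLog {u : ℝ≥0∞} (hu : u ≤ 1) : expNeg (negLog u) = u := by
  rw [negLog, expNeg, EReal.coe_toENNReal]
  · simp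
  · simpa using hu

lemma expNeg_injective : Function.Injective expNeg :=
  Function.LeftInverse.injective negLog_expNeg

lemma measurable_negLog : Measurable negLog := by
  unfold negLog
  exact measurable_ereal_toENNReal.comp
    ((continuous_neg.comp ENNReal.continuous_log).measurable)

lemma expNeg_nsmul (n : ℕ) (x : ℝ≥0∞) : expNeg (n * x) = expNeg x ^ n := by
  induction n with
  | zero => simp
  | succ k ih => rw [Nat.cast_succ, add_mul, expNeg_add, ih, one_mul, pow_succ]

lemma expNeg_finset_sum {ι : Type*} (s : Finset ι) (f : ι → ℝ≥0∞) :
    expNeg (∑ i ∈ s, f i) = ∏ i ∈ s, expNeg (f i) := by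
  classical
  induction s using Finset.induction_on with
  | empty => simp
  | insert a s ha ih => rw [Finset.sum_insert ha, Finset.prod_insert ha, expNeg_add, ih]

/-- Writing an infinite product of factors in [0, 1] as `expNeg` of a sum avoids any convergence
question, since every sum in [0, ∞] converges and `expNeg` is continuous up to ∞. -/
lemma tendsto_prod_expNeg {ι : Type*} (f : ι → ℝ≥0∞) :
    Tendsto (fun s : Finset ι => ∏ i ∈ s, expNeg (f i)) atTop (𝓝 (expNeg (∑' i, f i))) := by
  have := (continuous_expNeg.tendsto _).comp (ENNReal.summable (f := f)).hasSum
  refine this.congr fun s => ?_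
  simp [expNeg_finset_sum]

/-! ### Integration of ψ exp(-∫ψ) -/

/-- Composition of an absolutely continuous function with a Lipschitz function. -/
lemma absolutelyContinuousOnInterval_comp {f g : ℝ → ℝ} {a b : ℝ} {s : Set ℝ}
    (hf : AbsolutelyContinuousOnInterval f a b) (hg : LipschitzOnWith 1 g s)
    (hs : ∀ x ∈ uIcc a b, f x ∈ s) : AbsolutelyContinuousOnInterval (fun x => g (f x)) a b := by
  rw [absolutelyContinuousOnInterval_iff] at hf ⊢
  intro ε hε
  obtain ⟨δ, hδ, h⟩ := hf ε hε
  refine ⟨δ, hδ, fun E hE hE' => lt_of_le_of_lt (Finset.sum_le_sum fun i hi => ?_) (h E hE hE')⟩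
  have := hE.1 i hi
  simpa using hg.dist_le_mul _ (hs _ this.1) _ (hs _ this.2)

lemma lipschitzOnWith_exp_neg : LipschitzOnWith 1 (fun x : ℝ => Real.exp (-x)) (Ici 0) := by
  refine Convex.lipschitzOnWith_of_nnnorm_hasDerivWithin_le (f' := fun x => -Real.exp (-x))
    (convex_Ici 0) (fun x _ => ?_) (fun x hx => ?_)
  · simpa using ((hasDerivAt_neg x).exp).hasDerivWithinAt
  · rw [← NNReal.coe_le_coe]
    simpa using hx

/-- The integrand is minus the derivative of exp(-∫ψ). As ψ is merely integrable, this derivative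
exists only almost everywhere. The fundamental theorem still applies, because the primitive of ψ is
absolutely continuous and nonnegative, and exp(-x) is 1-Lipschitz on [0, ∞). -/
lemma integral_mul_exp_neg_integral {ψ : ℝ → ℝ} {a b : ℝ} (hab : a ≤ b)
    (hψ : IntervalIntegrable ψ volume a b) (h0 : ∀ x, 0 ≤ ψ x) :
    ∫ t in a..b, ψ t * Real.exp (-∫ s in a..t, ψ s) = 1 - Real.exp (-∫ s in a..b, ψ s) := by
  have hac := hψ.absolutelyContinuousOnInterval_intervalIntegral (c := a) (by simp)
  have hac' : AbsolutelyContinuousOnInterval (fun t => Real.exp (-∫ s in a..t, ψ s)) a b := by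
    refine absolutelyContinuousOnInterval_comp (g := fun x => Real.exp (-x)) hac lipschitzOnWith_exp_neg fun x hx => ?_
    rw [uIcc_of_le hab] at hx
    exact intervalIntegral.integral_nonneg hx.1 fun u _ => h0 u
  have h := hac'.integral_deriv_eq_sub
  have h2 : ∫ t in a..b, deriv (fun t => Real.exp (-∫ s in a..t, ψ s)) t =
      ∫ t in a..b, -(ψ t * Real.exp (-∫ s in a..t, ψ s)) := by
    apply intervalIntegral.integral_congr_ae
    filter_upwards [hψ.ae_hasDerivAt_integral] with x hx hx2
    have := (hx (uIoc_subset_uIcc hx2) a (by simp)).fun_neg.exp.deriv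
    rw [this]; ring
  rw [h2, intervalIntegral.integral_neg] at h
  simp at h
  linarith

lemma lintegral_mul_expNeg_lintegral {ψ : ℝ → ℝ≥0∞} (hψ : Measurable ψ) {a b : ℝ} (hab : a ≤ b)
    (hfin : ∫⁻ t in Ioc a b, ψ t ≠ ⊤) :
    ∫⁻ t in Ioc a b, ψ t * expNeg (∫⁻ s in Ioc a t, ψ s) =
      1 - expNeg (∫⁻ t in Ioc a b, ψ t) := by
  have hint : IntegrableOn (fun t => (ψ t).toReal) (Ioc a b) :=
    integrable_toReal_of_lintegral_ne_top hψ.aemeasurable hfin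
  have hii : IntervalIntegrable (fun t => (ψ t).toReal) volume a b :=
    (intervalIntegrable_iff_integrableOn_Ioc_of_le hab).2 hint
  have key := integral_mul_exp_neg_integral hab hii (fun _ => ENNReal.toReal_nonneg)
  have hlin : ∀ t ∈ Icc a b, ∫⁻ s in Ioc a t, ψ s =
      ENNReal.ofReal (∫ s in a..t, (ψ s).toReal) := by
    intro t ht
    have hsub : Ioc a t ⊆ Ioc a b := Ioc_subset_Ioc_right ht.2
    have hfin' : ∫⁻ s in Ioc a t, ψ s ≠ ⊤ := ne_top_of_le_ne_top hfin (lintegral_mono_set hsub)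
    rw [intervalIntegral.integral_of_le ht.1,
      integral_toReal hψ.aemeasurable (ae_lt_top hψ hfin'), ENNReal.ofReal_toReal hfin']
  have hnn : ∀ t ∈ Icc a b, 0 ≤ ∫ s in a..t, (ψ s).toReal := fun t ht =>
    intervalIntegral.integral_nonneg ht.1 fun u _ => ENNReal.toReal_nonneg
  rw [hlin b (right_mem_Icc.2 hab), expNeg_ofReal (hnn b (right_mem_Icc.2 hab)),
    ← ENNReal.ofReal_one, ← ENNReal.ofReal_sub _ (Real.exp_pos _).le, ← key,
    intervalIntegral.integral_of_le hab, ofReal_integral_eq_lintegral_ofReal]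
  · refine setLIntegral_congr_fun_ae measurableSet_Ioc ?_
    have hlt := (ae_restrict_iff' measurableSet_Ioc).1 (ae_lt_top hψ hfin)
    filter_upwards [hlt] with t ht htm
    have htm' : t ∈ Icc a b := Ioc_subset_Icc_self htm
    rw [hlin t htm', expNeg_ofReal (hnn t htm'), ENNReal.ofReal_mul ENNReal.toReal_nonneg,
      ENNReal.ofReal_toReal (ht htm).ne]
  · rw [← IntegrableOn, ← intervalIntegrable_iff_integrableOn_Ioc_of_le hab]
    refine hii.mul_continuousOn (Real.continuous_exp.comp_continuousOn ?_)
    exact (hii.absolutelyContinuousOnInterval_intervalIntegral (c := a) (by simp)).continuousOn.neg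
  · exact Eventually.of_forall fun t => mul_nonneg ENNReal.toReal_nonneg (Real.exp_pos _).le

/-! ### Uniqueness of Laplace transforms -/

/-- A finite measure on `[0, ∞]` is determined by its Laplace transform at the natural numbers. -/
lemma measure_ext_of_lintegral_expNeg {μ ν : Measure ℝ≥0∞} [IsFiniteMeasure μ] [IsFiniteMeasure ν]
    (h : ∀ n : ℕ, ∫⁻ x, expNeg x ^ n ∂μ = ∫⁻ x, expNeg x ^ n ∂ν) : μ = ν := by
  have hcont : Continuous fun x => (expNeg x).toReal :=
    ENNReal.continuousOn_toReal.comp_continuous continuous_expNeg expNeg_ne_top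
  let e : BoundedContinuousFunction ℝ≥0∞ ℝ := BoundedContinuousFunction.ofNormedAddCommGroup
    (fun x => (expNeg x).toReal) hcont 1 (fun x => by
      rw [Real.norm_of_nonneg ENNReal.toReal_nonneg]
      exact ENNReal.toReal_le_of_le_ofReal zero_le_one (by simpa using expNeg_le_one x))
  have hpow : ∀ n : ℕ, ∫ x, (e x) ^ n ∂μ = ∫ x, (e x) ^ n ∂ν := by
    have haux : ∀ (n : ℕ) (κ : Measure ℝ≥0∞) [IsFiniteMeasure κ],
        ∫ x, (e x) ^ n ∂κ = (∫⁻ x, expNeg x ^ n ∂κ).toReal := by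
      intro n κ _
      rw [← integral_toReal (measurable_expNeg.pow_const n).aemeasurable]
      · simp [e, BoundedContinuousFunction.coe_ofNormedAddCommGroup]
      · exact Eventually.of_forall fun x => ENNReal.pow_lt_top (expNeg_ne_top x).lt_top
    intro n
    rw [haux, haux, h]
  -- The polynomials in `e` form a subalgebra that separates points, since `expNeg` is injective.
  -- The case n = 0 of the hypothesis takes care of the constants.
  let A : StarSubalgebra ℝ (BoundedContinuousFunction ℝ≥0∞ ℝ) :=
    { Algebra.adjoin ℝ {e} with
      star_mem' := fun {a} ha => by
        have : star a = a := by ext x; simp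
        rw [this]; exact ha }
  refine ext_of_forall_mem_subalgebra_integral_eq_of_polish (𝕜 := ℝ) (A := A) ?_ ?_
  · intro x y hxy
    refine ⟨e, ⟨BoundedContinuousFunction.toContinuousMapStarₐ ℝ e, ?_, rfl⟩, ?_⟩
    · exact ⟨e, Algebra.self_mem_adjoin_singleton ℝ e, rfl⟩
    · intro hh
      exact hxy (expNeg_injective ((ENNReal.toReal_eq_toReal_iff' (expNeg_ne_top x)
        (expNeg_ne_top y)).1 hh))
  · intro g hg
    have hg' : g ∈ Algebra.adjoin ℝ {e} := hg
    rw [Algebra.adjoin_singleton_eq_range_aeval] at hg'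
    obtain ⟨q, rfl⟩ := hg'
    induction q using Polynomial.induction_on' with
    | add p q hp hq =>
      have hi : ∀ (κ : Measure ℝ≥0∞) [IsFiniteMeasure κ] (g : BoundedContinuousFunction ℝ≥0∞ ℝ),
        Integrable g κ := fun κ _ g => g.integrable κ
      have hp' := hp
        (by change _ ∈ Algebra.adjoin ℝ {e}; exact Polynomial.aeval_mem_adjoin_singleton ℝ e)
      have hq' := hq
        (by change _ ∈ Algebra.adjoin ℝ {e}; exact Polynomial.aeval_mem_adjoin_singleton ℝ e)
      simp only [map_add, BoundedContinuousFunction.coe_add, Pi.add_apply] at hp' hq' ⊢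
      rw [integral_add (hi _ _) (hi _ _), integral_add (hi _ _) (hi _ _), hp', hq']
    | monomial n a =>
      simp [Polynomial.aeval_monomial, integral_const_mul, hpow]

/-! ### Infinite products of independent factors -/

section Gains

variable {Ω : Type*} [MeasurableSpace Ω] {P : Measure Ω}

/-- Independence gives the identity for finite partial products. These are bounded by 1, and
countability of the index set allows dominated convergence along finite subsets. With `negLog` the
limit of the product of expectations is again a sum, which may be infinite. -/
lemma lintegral_expNeg_tsum_of_iIndepFun {κ : Type*} [Countable κ] {E : Type*} [MeasurableSpace E]
    {Y : κ → Ω → E} (hY : ∀ k, Measurable (Y k)) (hind : iIndepFun Y P)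
    {w : κ → E → ℝ≥0∞} (hw : ∀ k, Measurable (w k)) :
    ∫⁻ ω, expNeg (∑' k, w k (Y k ω)) ∂P =
      expNeg (∑' k, negLog (∫⁻ ω, expNeg (w k (Y k ω)) ∂P)) := by
  have : IsProbabilityMeasure P := hind.isProbabilityMeasure
  have hm : ∀ k, Measurable fun ω => expNeg (w k (Y k ω)) := fun k =>
    measurable_expNeg.comp ((hw k).comp (hY k))
  have hle : ∀ k, ∫⁻ ω, expNeg (w k (Y k ω)) ∂P ≤ 1 := fun k =>
    (lintegral_mono fun ω => expNeg_le_one _).trans (by simp)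
  have h1 : Tendsto (fun s : Finset κ => ∫⁻ ω, ∏ k ∈ s, expNeg (w k (Y k ω)) ∂P) atTop
      (𝓝 (∫⁻ ω, expNeg (∑' k, w k (Y k ω)) ∂P)) := by
    refine tendsto_lintegral_filter_of_dominated_convergence (fun _ => 1)
      (Eventually.of_forall fun s => Finset.measurable_prod s fun k _ => hm k)
      (Eventually.of_forall fun s => Eventually.of_forall fun ω => ?_) (by simp)
      (Eventually.of_forall fun ω => tendsto_prod_expNeg fun k => w k (Y k ω))
    exact Finset.prod_le_one' fun k _ => expNeg_le_one _
  have h2 := tendsto_prod_expNeg fun k => negLog (∫⁻ ω, expNeg (w k (Y k ω)) ∂P)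
  refine tendsto_nhds_unique h1 (h2.congr fun s => ?_)
  rw [lintegral_prod_eq_prod_lintegral_of_indepFun s (fun k ω => expNeg (w k (Y k ω)))
    (hind.comp (fun k x => expNeg (w k x)) fun k => measurable_expNeg.comp (hw k)) hm]
  exact Finset.prod_congr rfl fun k _ => expNeg_negLog (hle k)

end Gains

/-! ### The Laplace functional of a Poisson process -/

section Poisson

lemma tsum_indicator_const {Ω : Type*} (X : ℕ → Ω → Plane) (B : Set Plane) (c : ℝ≥0∞) (ω : Ω) :
    ∑' i, B.indicator (fun _ => c) (X i ω) = (pointCount X B ω : ℝ≥0∞) * c := by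
  have h := ENNReal.tsum_set_const {i : ℕ | X i ω ∈ B} c
  rw [tsum_subtype {i : ℕ | X i ω ∈ B} (fun _ => c)] at h
  exact h

variable {Ω : Type*} [MeasurableSpace Ω] {P : Measure Ω}

lemma lintegral_pow_poissonMeasure (m : ℝ≥0) {q : ℝ≥0∞} (hq : q ≤ 1) :
    ∫⁻ n, q ^ n ∂(poissonMeasure m) = expNeg (m * (1 - q)) := by
  lift q to ℝ≥0 using ne_top_of_le_ne_top ENNReal.one_ne_top hq
  have hq' : (q : ℝ) ≤ 1 := by exact_mod_cast hq
  rw [lintegral_countable']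
  have hterm : ∀ n : ℕ, (q : ℝ≥0∞) ^ n * poissonMeasure m {n} =
      ENNReal.ofReal (Real.exp (-m) * ((m * q : ℝ) ^ n / (n.factorial : ℝ))) := by
    intro n
    rw [poissonMeasure_singleton, ← ENNReal.ofReal_coe_nnreal (p := q),
      ← ENNReal.ofReal_pow q.coe_nonneg, ← ENNReal.ofReal_mul (by positivity)]
    congr 1
    ring
  have hs := (NormedSpace.expSeries_div_hasSum_exp (m * q : ℝ)).mul_left (Real.exp (-m))
  simp_rw [hterm]
  rw [← ENNReal.ofReal_tsum_of_nonneg (fun n => by positivity) hs.summable, hs.tsum_eq,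
    ← Real.exp_eq_exp_ℝ, ← Real.exp_add]
  have : (m : ℝ≥0∞) * (1 - q) = ENNReal.ofReal (m * (1 - q)) := by
    rw [ENNReal.ofReal_mul m.coe_nonneg, ENNReal.ofReal_sub _ q.coe_nonneg]
    simp
  rw [this, expNeg_ofReal (mul_nonneg m.coe_nonneg (sub_nonneg.2 hq'))]
  congr 2
  ring

variable {X : ℕ → Ω → Plane} {μ : Measure Plane}

/-- Measurability is forced by the law: the pushforward under a map that is not a.e. measurable is 0
by convention, whereas the Poisson law has mass 1. -/
lemma IsPoissonProcess.aemeasurable_pointCount (hX : IsPoissonProcess P X μ) [NeZero P]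
    {B : Set Plane} (hB : MeasurableSet B) (hμ : μ B < ∞) : AEMeasurable (pointCount X B) P := by
  by_contra h
  have h1 := hX.law B hB hμ
  rw [Measure.map_of_not_aemeasurable h] at h1
  have h2 : (poissonMeasure (μ B).toNNReal).map (fun n : ℕ => (n : ℕ∞)) univ = 1 := by
    rw [Measure.map_apply (measurable_from_nat) MeasurableSet.univ]
    simp
  rw [← h1] at h2
  simp at h2

lemma IsPoissonProcess.lintegral_comp_pointCount (hX : IsPoissonProcess P X μ) [NeZero P]
    {B : Set Plane} (hB : MeasurableSet B) (hμ : μ B < ∞) (g : ℕ∞ → ℝ≥0∞) :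
    ∫⁻ ω, g (pointCount X B ω) ∂P = ∫⁻ n : ℕ, g n ∂(poissonMeasure (μ B).toNNReal) := by
  rw [← lintegral_map' (f := g) (g := pointCount X B) (Measurable.of_discrete).aemeasurable
    (hX.aemeasurable_pointCount hB hμ), hX.law B hB hμ,
    lintegral_map Measurable.of_discrete measurable_from_nat]

lemma IsPoissonProcess.lintegral_expNeg_pointCount (hX : IsPoissonProcess P X μ) [NeZero P]
    {B : Set Plane} (hB : MeasurableSet B) (hμ : μ B < ∞) (c : ℝ≥0∞) :
    ∫⁻ ω, expNeg ((pointCount X B ω : ℝ≥0∞) * c) ∂P = expNeg ((1 - expNeg c) * μ B) := by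
  rw [hX.lintegral_comp_pointCount hB hμ (fun n => expNeg ((n : ℝ≥0∞) * c))]
  have : ∀ n : ℕ, expNeg (((n : ℕ∞) : ℝ≥0∞) * c) = expNeg c ^ n := fun n => by
    rw [← expNeg_nsmul]; simp
  simp_rw [this]
  rw [lintegral_pow_poissonMeasure _ (expNeg_le_one c), ENNReal.coe_toNNReal hμ.ne, mul_comm]

/-- The sum equals ∑ c N(g = c), where the counts over the disjoint level sets are independent
Poisson variables. The generating function of each count supplies one factor. -/
lemma IsPoissonProcess.lintegral_expNeg_tsum_simpleFunc (hX : IsPoissonProcess P X μ)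
    [IsProbabilityMeasure P] (g : SimpleFunc Plane ℝ≥0∞) (hg : ∀ c ≠ 0, μ (g ⁻¹' {c}) < ∞) :
    ∫⁻ ω, expNeg (∑' i, g (X i ω)) ∂P = expNeg (∫⁻ x, (1 - expNeg (g x)) ∂μ) := by
  classical
  -- The value 0 is left out because its level set may have infinite intensity; it contributes
  -- nothing on either side.
  set s : Finset ℝ≥0∞ := g.range.filter (· ≠ 0) with hs
  have hs0 : ∀ c : s, (c : ℝ≥0∞) ≠ 0 := fun c => (Finset.mem_filter.1 c.2).2
  have hsum : ∀ x, g x = ∑ c : s, (g ⁻¹' {(c : ℝ≥0∞)}).indicator (fun _ => (c : ℝ≥0∞)) x := by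
    intro x
    rw [Finset.sum_coe_sort s fun c => (g ⁻¹' {c}).indicator (fun _ => c) x]
    by_cases hx : g x = 0
    · rw [hx]
      refine (Finset.sum_eq_zero fun c hc => indicator_of_notMem ?_ _).symm
      rintro h
      exact (Finset.mem_filter.1 hc).2 (by rw [← hx]; exact h.symm)
    · rw [Finset.sum_eq_single (g x)]
      · simp
      · intro c _ hc
        exact indicator_of_notMem (fun h => hc h.symm) _
      · intro h
        exact absurd (Finset.mem_filter.2 ⟨g.mem_range_self x, hx⟩) h
  have hmeas : ∀ c : s, MeasurableSet (g ⁻¹' {(c : ℝ≥0∞)}) := fun c => g.measurableSet_fiber _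
  have hN : ∀ c : s, AEMeasurable (pointCount X (g ⁻¹' {(c : ℝ≥0∞)})) P := fun c =>
    hX.aemeasurable_pointCount (hmeas c) (hg c (hs0 c))
  have hind : iIndepFun (fun c : s => pointCount X (g ⁻¹' {(c : ℝ≥0∞)})) P := by
    have h := hX.indep s.card (fun k => g ⁻¹' {((s.equivFin.symm k : s) : ℝ≥0∞)})
      (fun k => hmeas _) (fun k => hg _ (hs0 _)) (fun k l hkl => by
        refine Disjoint.preimage _ (disjoint_singleton.2 fun h => hkl ?_)
        exact s.equivFin.symm.injective (Subtype.ext h))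
    have h' := h.precomp (g := s.equivFin) s.equivFin.injective
    simpa using h'
  have h1 : ∀ ω, expNeg (∑' i, g (X i ω)) =
      ∏ c : s, expNeg ((pointCount X (g ⁻¹' {(c : ℝ≥0∞)}) ω : ℝ≥0∞) * c) := by
    intro ω
    rw [← expNeg_finset_sum]
    congr 1
    simp_rw [← tsum_indicator_const]
    rw [← Summable.tsum_finsetSum fun _ _ => ENNReal.summable]
    exact tsum_congr fun i => hsum _
  simp_rw [h1]
  have hprod : ∫⁻ ω, ∏ c : s, expNeg ((pointCount X (g ⁻¹' {(c : ℝ≥0∞)}) ω : ℝ≥0∞) * c) ∂P =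
      ∏ c : s, ∫⁻ ω, expNeg ((pointCount X (g ⁻¹' {(c : ℝ≥0∞)}) ω : ℝ≥0∞) * c) ∂P := by
    have hm : ∀ c : s, Measurable fun n : ℕ∞ => expNeg ((n : ℝ≥0∞) * c) := fun c =>
      Measurable.of_discrete
    -- The counts are only a.e. measurable, so the product formula is applied to measurable
    -- modifications.
    have hae : ∀ᵐ ω ∂P, ∀ c : s, pointCount X (g ⁻¹' {(c : ℝ≥0∞)}) ω = (hN c).mk _ ω :=
      ae_all_iff.2 fun c => (hN c).ae_eq_mk
    have hind' : iIndepFun (fun c : s => (hN c).mk _) P :=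
      hind.congr fun c => (hN c).ae_eq_mk
    have := lintegral_prod_eq_prod_lintegral_of_indepFun Finset.univ
      (fun (c : s) ω => expNeg (((hN c).mk _ ω : ℝ≥0∞) * c))
      (hind'.comp (fun c n => expNeg ((n : ℝ≥0∞) * c)) hm)
      (fun c => (hm c).comp (hN c).measurable_mk)
    rw [lintegral_congr_ae (g := fun ω => ∏ c : s, expNeg (((hN c).mk _ ω : ℝ≥0∞) * c)), this]
    · refine Finset.prod_congr rfl fun c _ => lintegral_congr_ae ?_
      filter_upwards [hae] with ω hω
      rw [hω c]
    · filter_upwards [hae] with ω hω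
      simp_rw [hω]
  rw [hprod]
  simp_rw [fun c : s => hX.lintegral_expNeg_pointCount (hmeas c) (hg c (hs0 c)) (c : ℝ≥0∞)]
  rw [← expNeg_finset_sum]
  congr 1
  have h2 : ∫⁻ x, (1 - expNeg (g x)) ∂μ = ∑ c ∈ g.range, (1 - expNeg c) * μ (g ⁻¹' {c}) := by
    rw [← SimpleFunc.map_lintegral (fun c => 1 - expNeg c) g, ← SimpleFunc.lintegral_eq_lintegral]
    rfl
  rw [h2, Finset.sum_coe_sort s fun c => (1 - expNeg c) * μ (g ⁻¹' {c}), hs]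
  refine Finset.sum_filter_of_ne fun c _ hc h0 => hc ?_
  simp [h0]

/-- The Laplace functional of a Poisson process. -/
theorem IsPoissonProcess.lintegral_expNeg_tsum (hX : IsPoissonProcess P X μ)
    [IsProbabilityMeasure P] (hμ : ∀ r, μ (Metric.closedBall 0 r) < ∞) {f : Plane → ℝ≥0∞}
    (hf : Measurable f) :
    ∫⁻ ω, expNeg (∑' i, f (X i ω)) ∂P = expNeg (∫⁻ x, (1 - expNeg (f x)) ∂μ) := by
  -- Restriction to the ball of radius n makes the nonzero level sets of finite intensity, and the
  -- sequence still increases to f.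
  let g : ℕ → SimpleFunc Plane ℝ≥0∞ := fun n =>
    (SimpleFunc.eapprox f n).restrict (Metric.closedBall 0 n)
  have hgx : ∀ n x, g n x = (Metric.closedBall (0 : Plane) n).indicator
      (SimpleFunc.eapprox f n) x := fun n x =>
    SimpleFunc.restrict_apply _ Metric.isClosed_closedBall.measurableSet _
  have hmono : ∀ x, Monotone fun n => g n x := by
    intro x m n hmn
    simp only [hgx]
    exact (indicator_le_indicator_of_subset
      (Metric.closedBall_subset_closedBall (by exact_mod_cast hmn)) (fun _ => zero_le) x).trans
      (indicator_le_indicator (SimpleFunc.monotone_eapprox f hmn x))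
  have hlim : ∀ x, Tendsto (fun n => g n x) atTop (𝓝 (f x)) := by
    intro x
    refine (SimpleFunc.tendsto_eapprox hf x).congr' ?_
    filter_upwards [eventually_ge_atTop ⌈‖x‖⌉₊] with n hn
    rw [hgx, indicator_of_mem]
    simpa using (Nat.le_ceil _).trans (by exact_mod_cast hn)
  have hn : ∀ n, ∫⁻ ω, expNeg (∑' i, g n (X i ω)) ∂P =
      expNeg (∫⁻ x, (1 - expNeg (g n x)) ∂μ) := by
    intro n
    refine hX.lintegral_expNeg_tsum_simpleFunc (g n) fun c hc => ?_
    refine (measure_mono fun x hx => ?_).trans_lt (hμ n)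
    by_contra hxn
    have hx' : g n x = c := hx
    rw [hgx, indicator_of_notMem hxn] at hx'
    exact hc hx'.symm
  have htsum : ∀ ω, Tendsto (fun n => ∑' i, g n (X i ω)) atTop (𝓝 (∑' i, f (X i ω))) := by
    intro ω
    -- The sum is an integral for the counting measure, so monotone convergence applies.
    have := lintegral_tendsto_of_tendsto_of_monotone (μ := Measure.count)
      (f := fun n (i : ℕ) => g n (X i ω)) (F := fun i => f (X i ω))
      (fun n => (Measurable.of_discrete).aemeasurable)
      (Eventually.of_forall fun i => hmono _) (Eventually.of_forall fun i => hlim _)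
    simpa [lintegral_count] using this
  have h1 : Tendsto (fun n => ∫⁻ ω, expNeg (∑' i, g n (X i ω)) ∂P) atTop
      (𝓝 (∫⁻ ω, expNeg (∑' i, f (X i ω)) ∂P)) := by
    refine tendsto_lintegral_of_dominated_convergence (fun _ => 1) (fun n => ?_)
      (fun n => Eventually.of_forall fun ω => expNeg_le_one _) (by simp)
      (Eventually.of_forall fun ω => (continuous_expNeg.tendsto _).comp (htsum ω))
    exact measurable_expNeg.comp (Measurable.tsum fun i => (g n).measurable.comp (hX.measurable i))
  have h2 : Tendsto (fun n => ∫⁻ x, (1 - expNeg (g n x)) ∂μ) atTop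
      (𝓝 (∫⁻ x, (1 - expNeg (f x)) ∂μ)) := by
    refine lintegral_tendsto_of_tendsto_of_monotone (fun n => ?_)
      (Eventually.of_forall fun x m n hmn => tsub_le_tsub_left (expNeg_anti (hmono x hmn)) _)
      (Eventually.of_forall fun x => ?_)
    · exact (measurable_const.sub (measurable_expNeg.comp (g n).measurable)).aemeasurable
    · exact ENNReal.Tendsto.sub tendsto_const_nhds
        ((continuous_expNeg.tendsto _).comp (hlim x)) (Or.inl ENNReal.one_ne_top)
  refine tendsto_nhds_unique h1 ?_
  simp_rw [hn]
  exact (continuous_expNeg.tendsto _).comp h2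

end Poisson

/-! ### The first index that attains an infimum -/

/-- The index of the first term of a real sequence that attains the infimum. -/
noncomputable def nearest (d : ℕ → ℝ) : ℕ := sInf {i | d i = ⨅ k, d k}

lemma exists_eq_iInf_of_finite {d : ℕ → ℝ} (hd : ∀ i, 0 ≤ d i) (hfin : ∀ r, {i | d i ≤ r}.Finite) :
    ∃ j, d j = ⨅ k, d k := by
  have hb : BddBelow (range d) := ⟨0, by rintro _ ⟨i, rfl⟩; exact hd i⟩
  obtain ⟨j, hj, hmin⟩ := exists_min_image {i | d i ≤ d 0} d (hfin _) ⟨0, le_refl (d 0)⟩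
  refine ⟨j, le_antisymm (le_ciInf fun k => ?_) (ciInf_le hb j)⟩
  by_cases hk : d k ≤ d 0
  · exact hmin k hk
  · exact hj.trans (not_le.1 hk).le

lemma apply_nearest {d : ℕ → ℝ} (h : ∃ j, d j = ⨅ k, d k) : d (nearest d) = ⨅ k, d k :=
  Nat.sInf_mem (s := {i | d i = ⨅ k, d k}) h

lemma measurable_iInf_seq : Measurable fun d : ℕ → ℝ => ⨅ k, d k :=
  Measurable.iInf fun k => measurable_pi_apply k

lemma measurable_nearest : Measurable nearest := by
  have hS : ∀ i, MeasurableSet {d : ℕ → ℝ | d i = ⨅ k, d k} := fun i =>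
    measurableSet_eq_fun (measurable_pi_apply i) measurable_iInf_seq
  refine measurable_of_Iic fun n => ?_
  -- If the infimum is not attained, then `nearest` is `sInf ∅ = 0`, so all such sequences lie in
  -- the preimage for every n.
  have : nearest ⁻¹' Iic n = (⋃ i ∈ Finset.range (n + 1), {d : ℕ → ℝ | d i = ⨅ k, d k}) ∪
      ⋂ i, {d : ℕ → ℝ | d i = ⨅ k, d k}ᶜ := by
    ext d
    simp only [mem_preimage, mem_Iic, mem_union, mem_iUnion, Finset.mem_range, mem_iInter,
      mem_ofPred_eq, mem_compl_iff, exists_prop]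
    constructor
    · intro h
      by_cases he : ∃ j, d j = ⨅ k, d k
      · exact Or.inl ⟨nearest d, Nat.lt_succ_of_le h, apply_nearest he⟩
      · exact Or.inr fun i hi => he ⟨i, hi⟩
    · rintro (⟨i, hi, h⟩ | h)
      · exact (Nat.sInf_le (s := {i | d i = ⨅ k, d k}) h).trans (Nat.le_of_lt_succ hi)
      · have : {i | d i = ⨅ k, d k} = ∅ := by
          ext i; simpa using h i
        simp [nearest, this]
  rw [this]
  exact (Finset.measurableSet_biUnion _ fun i _ => hS i).union (MeasurableSet.iInter fun i => (hS i).compl)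

/-! ### The nearest point of a Poisson process -/

section NearestPoint

variable {Ω : Type*} [MeasurableSpace Ω] {P : Measure Ω} {X : ℕ → Ω → Plane} {μ : Measure Plane}
  {δ : Plane → ℝ}

/-- A Poisson count of finite mean is almost surely finite; this is applied to the balls of integer
radius. It ensures that the infimum of the distances is attained. -/
lemma IsPoissonProcess.ae_finite (hX : IsPoissonProcess P X μ) [NeZero P]
    (hμ : ∀ r, μ (Metric.closedBall 0 r) < ∞) (hδ : ∀ x, ‖x‖ ≤ δ x) :
    ∀ᵐ ω ∂P, ∀ r, {i | δ (X i ω) ≤ r}.Finite := by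
  have h : ∀ n : ℕ, ∀ᵐ ω ∂P, pointCount X (Metric.closedBall 0 n) ω ≠ ⊤ := by
    intro n
    have hB : MeasurableSet (Metric.closedBall (0 : Plane) n) :=
      Metric.isClosed_closedBall.measurableSet
    have := hX.lintegral_comp_pointCount hB (hμ n) (fun k => if k = ⊤ then 1 else 0)
    simp only [ENat.natCast_ne_top, if_false, lintegral_zero] at this
    have hm : AEMeasurable (fun ω => if pointCount X (Metric.closedBall 0 n) ω = ⊤ then (1 : ℝ≥0∞)
        else 0) P :=
      (Measurable.of_discrete (f := fun k : ℕ∞ => if k = ⊤ then (1 : ℝ≥0∞) else 0)).comp_aemeasurable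
        (hX.aemeasurable_pointCount hB (hμ n))
    rw [lintegral_eq_zero_iff' hm] at this
    filter_upwards [this] with ω hω ht
    simp [ht] at hω
  filter_upwards [ae_all_iff.2 h] with ω hω r
  obtain ⟨n, hn⟩ := exists_nat_ge r
  have hf : {i : ℕ | X i ω ∈ Metric.closedBall (0 : Plane) n}.Finite := by
    rw [← Set.encard_ne_top_iff]
    exact hω n
  refine hf.subset fun i hi => ?_
  simpa using (hδ _).trans (le_trans hi hn)

/-- From exp(-m) ≥ 1 - m it follows that 1 - exp(-m)(1 + m) ≤ 1 - (1 - m)(1 + m) = m². The quadratic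
order is what excludes ties between distances. -/
lemma poissonMeasure_two_le (m : ℝ≥0) : poissonMeasure m {n | 2 ≤ n} ≤ (m : ℝ≥0∞) ^ 2 := by
  have hc : {n : ℕ | 2 ≤ n} = ({0, 1} : Set ℕ)ᶜ := by
    ext n
    simp only [mem_ofPred_eq, mem_compl_iff, mem_insert_iff, mem_singleton_iff]
    omega
  have h01 : (poissonMeasure m).real {0, 1} = Real.exp (-m) + Real.exp (-m) * m := by
    have : ({0, 1} : Set ℕ) = {0} ∪ {1} := rfl
    rw [this, measureReal_union (by simp) (measurableSet_singleton 1),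
      poissonMeasure_real_singleton, poissonMeasure_real_singleton]
    simp
  have hreal : (poissonMeasure m).real {n | 2 ≤ n} ≤ (m : ℝ) ^ 2 := by
    rw [hc, probReal_compl_eq_one_sub (by measurability), h01]
    have h1 : 1 - (m : ℝ) ≤ Real.exp (-m) := by linarith [Real.add_one_le_exp (-(m : ℝ))]
    nlinarith [m.coe_nonneg]
  rw [← ofReal_measureReal]
  refine (ENNReal.ofReal_le_ofReal hreal).trans ?_
  rw [ENNReal.ofReal_pow m.coe_nonneg, ENNReal.ofReal_coe_nnreal]

lemma IsPoissonProcess.measure_two_le_pointCount_le (hX : IsPoissonProcess P X μ) [NeZero P]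
    {B : Set Plane} (hB : MeasurableSet B) (hμ : μ B < ∞) :
    P {ω | 2 ≤ pointCount X B ω} ≤ μ B ^ 2 := by
  have h : P {ω | 2 ≤ pointCount X B ω} = P.map (pointCount X B) {k | 2 ≤ k} := by
    rw [Measure.map_apply_of_aemeasurable (hX.aemeasurable_pointCount hB hμ)
      (MeasurableSet.of_discrete)]
    rfl
  rw [h, hX.law B hB hμ, Measure.map_apply measurable_from_nat MeasurableSet.of_discrete]
  have : (fun n : ℕ => (n : ℕ∞)) ⁻¹' {k | 2 ≤ k} = {n | 2 ≤ n} := by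
    ext n
    simp only [mem_preimage, mem_ofPred_eq]
    exact_mod_cast Iff.rfl
  rw [this]
  exact (poissonMeasure_two_le _).trans_eq (by rw [ENNReal.coe_toNNReal hμ.ne])

/-- If the distances have a locally bounded intensity, then almost surely they are distinct. -/
lemma IsPoissonProcess.ae_injective (hX : IsPoissonProcess P X μ) [NeZero P]
    (hδm : Measurable δ) (hδ : ∀ x, 0 ≤ δ x) {ℓ : ℝ → ℝ≥0∞}
    (hρ : μ.map δ = volume.withDensity ℓ) (hK : ∀ b, ∃ K : ℝ≥0, ∀ t ≤ b, ℓ t ≤ K) :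
    ∀ᵐ ω ∂P, Function.Injective fun i => δ (X i ω) := by
  have key : ∀ b : ℕ, P {ω | ∃ i k, i ≠ k ∧ δ (X i ω) = δ (X k ω) ∧ δ (X i ω) < b} = 0 := by
    intro b
    obtain ⟨K, hK⟩ := hK b
    have hshell : ∀ s t, t ≤ (b : ℝ) → μ (δ ⁻¹' Ico s t) ≤ K * ENNReal.ofReal (t - s) := by
      intro s t ht
      rw [← Measure.map_apply hδm measurableSet_Ico, hρ, withDensity_apply _ measurableSet_Ico]
      calc ∫⁻ x in Ico s t, ℓ x ≤ ∫⁻ x in Ico s t, K :=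
            setLIntegral_mono measurable_const fun x hx => hK x (hx.2.le.trans ht)
        _ = _ := by simp
    -- The interval [0, b) is cut into n + 1 shells, each of intensity at most K b / (n + 1). Two
    -- points at the same distance lie in one shell, which has probability at most the square of
    -- that bound. The sum over the shells is (K b)² / (n + 1), which tends to 0.
    have hn : ∀ n : ℕ, P {ω | ∃ i k, i ≠ k ∧ δ (X i ω) = δ (X k ω) ∧ δ (X i ω) < b} ≤
        ENNReal.ofReal ((K * b) ^ 2 / (n + 1)) := by
      intro n
      have hn0 : (0 : ℝ) < n + 1 := by positivity
      let S : ℕ → Set ℝ := fun s => Ico (s * (b / (n + 1))) ((s + 1) * (b / (n + 1)))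
      have hS : ∀ s ∈ Finset.range (n + 1), μ (δ ⁻¹' S s) ≤ ENNReal.ofReal (K * (b / (n + 1))) := by
        intro s hs
        have hs' : (s : ℝ) + 1 ≤ n + 1 := by exact_mod_cast Finset.mem_range.1 hs
        refine (hshell _ _ ?_).trans_eq ?_
        · calc ((s : ℝ) + 1) * (b / (n + 1)) ≤ (n + 1) * (b / (n + 1)) := by gcongr
            _ = b := by field_simp
        · rw [ENNReal.ofReal_mul K.coe_nonneg, ENNReal.ofReal_coe_nnreal]
          congr 2
          ring
      have hsub : {ω | ∃ i k, i ≠ k ∧ δ (X i ω) = δ (X k ω) ∧ δ (X i ω) < b} ⊆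
          ⋃ s ∈ Finset.range (n + 1), {ω | 2 ≤ pointCount X (δ ⁻¹' S s) ω} := by
        rintro ω ⟨i, k, hik, he, hlt⟩
        have hb : (0 : ℝ) < b := (hδ _).trans_lt hlt
        have hw : (0 : ℝ) < b / (n + 1) := by positivity
        set s := ⌊δ (X i ω) / (b / (n + 1))⌋₊ with hs
        have hs0 : 0 ≤ δ (X i ω) / (b / (n + 1)) := div_nonneg (hδ _) hw.le
        have h1 : (s : ℝ) * (b / (n + 1)) ≤ δ (X i ω) :=
          (le_div_iff₀ hw).1 (Nat.floor_le hs0)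
        have h2 : δ (X i ω) < (s + 1) * (b / (n + 1)) :=
          (div_lt_iff₀ hw).1 (Nat.lt_floor_add_one _)
        simp only [mem_iUnion, Finset.mem_range, mem_ofPred_eq, exists_prop]
        refine ⟨s, ?_, ?_⟩
        · rw [hs, Nat.floor_lt hs0, div_lt_iff₀ hw]
          push_cast
          calc δ (X i ω) < b := hlt
            _ = (n + 1) * (b / (n + 1)) := by field_simp
        · rw [pointCount, ← Set.encard_pair hik]
          refine encard_le_encard ?_
          rintro j (rfl | rfl)
          · exact ⟨h1, h2⟩
          · exact ⟨he ▸ h1, he ▸ h2⟩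
      calc _ ≤ P (⋃ s ∈ Finset.range (n + 1), {ω | 2 ≤ pointCount X (δ ⁻¹' S s) ω}) :=
            measure_mono hsub
        _ ≤ ∑ s ∈ Finset.range (n + 1), P {ω | 2 ≤ pointCount X (δ ⁻¹' S s) ω} :=
            measure_biUnion_finset_le _ _
        _ ≤ ∑ s ∈ Finset.range (n + 1), ENNReal.ofReal (K * (b / (n + 1))) ^ 2 := by
            refine Finset.sum_le_sum fun s hs => ?_
            refine (hX.measure_two_le_pointCount_le (hδm measurableSet_Ico)
              ((hS s hs).trans_lt ENNReal.ofReal_lt_top)).trans ?_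
            gcongr
            exact hS s hs
        _ = ENNReal.ofReal ((K * b) ^ 2 / (n + 1)) := by
            rw [Finset.sum_const, Finset.card_range, nsmul_eq_mul,
              ← ENNReal.ofReal_pow (by positivity), ← ENNReal.ofReal_natCast,
              ← ENNReal.ofReal_mul (by positivity)]
            congr 1
            push_cast
            field_simp
    have hlim : Tendsto (fun n : ℕ => ENNReal.ofReal ((K * b) ^ 2 / ((n : ℝ) + 1))) atTop (𝓝 0) := by
      rw [← ENNReal.ofReal_zero]
      refine ENNReal.tendsto_ofReal ?_
      exact tendsto_const_nhds.div_atTop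
        (tendsto_atTop_add_const_right _ _ tendsto_natCast_atTop_atTop)
    exact le_antisymm (ge_of_tendsto' hlim hn) zero_le
  have hall : ∀ᵐ ω ∂P, ∀ b : ℕ,
      ¬ ∃ i k, i ≠ k ∧ δ (X i ω) = δ (X k ω) ∧ δ (X i ω) < b := by
    refine ae_all_iff.2 fun b => ?_
    rw [ae_iff]
    simpa using key b
  filter_upwards [hall] with ω hω i k hik
  by_contra hne
  obtain ⟨b, hb⟩ := exists_nat_gt (δ (X i ω))
  exact hω b ⟨i, k, hne, hik, hb⟩

/-- Points at distance at most r receive the weight ∞. Since `expNeg ⊤ = 0`, the modified sum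
carries the indicator of the event within itself, and the Laplace functional applies directly.
Attainment of the infimum is needed for the converse: if it is at most r, some point really has
infinite weight. -/
lemma IsPoissonProcess.lintegral_expNeg_of_lt_iInf (hX : IsPoissonProcess P X μ)
    [IsProbabilityMeasure P] (hμ : ∀ r, μ (Metric.closedBall 0 r) < ∞) (hδm : Measurable δ)
    (hδ : ∀ x, ‖x‖ ≤ δ x) {F : ℝ → ℝ≥0∞} (hF : Measurable F) (r : ℝ) :
    ∫⁻ ω, {ω | r < ⨅ i, δ (X i ω)}.indicator (fun ω => expNeg (∑' i, F (δ (X i ω)))) ω ∂P =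
      expNeg (∫⁻ t, (if t ≤ r then 1 else 1 - expNeg (F t)) ∂(μ.map δ)) := by
  have hm : Measurable fun t => if t ≤ r then (1 : ℝ≥0∞) else 1 - expNeg (F t) :=
    Measurable.ite measurableSet_Iic measurable_const (measurable_const.sub (measurable_expNeg.comp hF))
  rw [lintegral_map hm hδm]
  have hf : Measurable fun x => if δ x ≤ r then (⊤ : ℝ≥0∞) else F (δ x) :=
    Measurable.ite (hδm measurableSet_Iic) measurable_const (hF.comp hδm)
  have h := hX.lintegral_expNeg_tsum hμ hf
  have h1 : ∫⁻ x, (1 - expNeg (if δ x ≤ r then (⊤ : ℝ≥0∞) else F (δ x))) ∂μ =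
      ∫⁻ x, (if δ x ≤ r then (1 : ℝ≥0∞) else 1 - expNeg (F (δ x))) ∂μ := by
    refine lintegral_congr fun x => ?_
    split_ifs <;> simp
  rw [← h1, ← h]
  refine lintegral_congr_ae ?_
  filter_upwards [hX.ae_finite hμ hδ] with ω hω
  have hd : ∀ i, 0 ≤ δ (X i ω) := fun i => (norm_nonneg _).trans (hδ _)
  have hb : BddBelow (range fun i => δ (X i ω)) := ⟨0, by rintro _ ⟨i, rfl⟩; exact hd i⟩
  by_cases hr : r < ⨅ i, δ (X i ω)
  · rw [indicator_of_mem (by exact hr)]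
    congr 1
    refine tsum_congr fun i => ?_
    rw [if_neg (not_le.2 (hr.trans_le (ciInf_le hb i)))]
  · rw [indicator_of_notMem (by exact hr)]
    obtain ⟨j, hj⟩ := exists_eq_iInf_of_finite hd hω
    have : (∑' i, if δ (X i ω) ≤ r then (⊤ : ℝ≥0∞) else F (δ (X i ω))) = ⊤ := by
      refine top_unique ((ENNReal.le_tsum j).trans' ?_)
      rw [if_pos (hj.trans_le (not_lt.1 hr))]
    rw [this, expNeg_top]

lemma IsPoissonProcess.measure_lt_iInf (hX : IsPoissonProcess P X μ)
    [IsProbabilityMeasure P] (hμ : ∀ r, μ (Metric.closedBall 0 r) < ∞) (hδm : Measurable δ)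
    (hδ : ∀ x, ‖x‖ ≤ δ x) (r : ℝ) :
    P {ω | r < ⨅ i, δ (X i ω)} = expNeg (μ.map δ (Iic r)) := by
  have h := hX.lintegral_expNeg_of_lt_iInf hμ hδm hδ (F := fun _ => 0) measurable_const r
  have hR : Measurable fun ω => ⨅ i, δ (X i ω) :=
    Measurable.iInf fun i => hδm.comp (hX.measurable i)
  simp only [tsum_zero, expNeg_zero, tsub_self] at h
  rw [lintegral_indicator (measurableSet_lt measurable_const hR)] at h
  simp only [lintegral_const, MeasurableSet.univ, Measure.restrict_apply, univ_inter,
    one_mul] at h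
  rw [h, ← lintegral_indicator_one measurableSet_Iic]
  rfl

/-- The joint law of the smallest distance and of a sum over the remaining points, expressed by
its Laplace transform. -/
theorem IsPoissonProcess.lintegral_nearest (hX : IsPoissonProcess P X μ)
    [IsProbabilityMeasure P] (hμ : ∀ r, μ (Metric.closedBall 0 r) < ∞) (hδm : Measurable δ)
    (hδ : ∀ x, ‖x‖ ≤ δ x) {ℓ : ℝ → ℝ≥0∞} (hℓ : Measurable ℓ)
    (hρ : μ.map δ = volume.withDensity ℓ) (hK : ∀ b, ∃ K : ℝ≥0, ∀ t ≤ b, ℓ t ≤ K)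
    {F : ℝ → ℝ≥0∞} (hF : Measurable F) (hFtop : ∀ t, F t ≠ ⊤) {G : ℝ → ℝ≥0∞} (hG : Measurable G) :
    ∫⁻ ω, G (⨅ i, δ (X i ω)) *
        expNeg (∑' i, if i = nearest (fun i => δ (X i ω)) then 0 else F (δ (X i ω))) ∂P =
      ∫⁻ r, G r * (ℓ r * expNeg (∫⁻ t, (if t ≤ r then 1 else 1 - expNeg (F t)) ∂(μ.map δ))) := by
  set R : Ω → ℝ := fun ω => ⨅ i, δ (X i ω) with hRdef
  have hR : Measurable R := Measurable.iInf fun i => hδm.comp (hX.measurable i)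
  set T : Ω → ℝ≥0∞ := fun ω => expNeg (∑' i, F (δ (X i ω))) with hTdef
  have hT : Measurable T := measurable_expNeg.comp
    (Measurable.tsum fun i => hF.comp (hδm.comp (hX.measurable i)))
  set D : ℝ → ℝ≥0∞ := fun r => ∫⁻ t, (if t ≤ r then 1 else 1 - expNeg (F t)) ∂(μ.map δ) with hDdef
  set ψ : ℝ → ℝ≥0∞ := fun t => expNeg (F t) * ℓ t with hψdef
  have heF : Measurable fun t => expNeg (F t) := measurable_expNeg.comp hF
  have hψ : Measurable ψ := heF.mul hℓ
  have hψfin : ∀ a b, ∫⁻ t in Ioc a b, ψ t ≠ ⊤ := by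
    intro a b
    obtain ⟨K, hK⟩ := hK b
    refine ne_top_of_le_ne_top (b := ∫⁻ t in Ioc a b, (K : ℝ≥0∞)) ?_ ?_
    · simp [ENNReal.mul_eq_top]
    · refine setLIntegral_mono measurable_const fun t ht => ?_
      calc ψ t ≤ 1 * ℓ t := by simp only [hψdef]; gcongr; exact expNeg_le_one _
        _ ≤ K := by rw [one_mul]; exact hK t ht.2
  -- When r increases from a to b, the integrand on (a, b] rises from 1 - exp(-F) to 1, hence by
  -- exp(-F).
  have hD : ∀ a b, a ≤ b → D b = D a + ∫⁻ t in Ioc a b, ψ t := by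
    intro a b hab
    have h1 : ∫⁻ t in Ioc a b, ψ t = ∫⁻ t, (Ioc a b).indicator (fun t => expNeg (F t)) t ∂(μ.map δ) := by
      rw [lintegral_indicator measurableSet_Ioc, hρ, setLIntegral_withDensity_eq_setLIntegral_mul _ hℓ
        heF measurableSet_Ioc]
      exact lintegral_congr fun t => mul_comm _ _
    rw [h1, hDdef]
    simp only
    rw [← lintegral_add_right _ (heF.indicator measurableSet_Ioc)]
    refine lintegral_congr fun t => ?_
    by_cases hta : t ≤ a
    · rw [if_pos hta, if_pos (hta.trans hab), indicator_of_notMem (fun h => not_lt.2 hta h.1),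
        add_zero]
    · by_cases htb : t ≤ b
      · rw [if_pos htb, if_neg hta, indicator_of_mem (mem_Ioc.2 ⟨not_le.1 hta, htb⟩),
          tsub_add_cancel_of_le (expNeg_le_one _)]
      · rw [if_neg htb, if_neg hta, indicator_of_notMem (fun h => htb h.2), add_zero]
  have hDm : Measurable fun r => expNeg (D r) := by
    refine Antitone.measurable fun a b hab => expNeg_anti ?_
    rw [hD a b hab]
    exact le_self_add
  -- This is the law of the nearest distance weighted by exp(-∑ F) over all points, the nearest one
  -- included. Its tails are known from the preceding lemma.
  set ν : Measure ℝ := (P.withDensity T).map R with hν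
  have hνfin : IsFiniteMeasure ν := by
    have : IsFiniteMeasure (P.withDensity T) := isFiniteMeasure_withDensity (by
      refine ne_top_of_le_ne_top (b := 1) (by simp) ?_
      exact (lintegral_mono fun ω => expNeg_le_one _).trans (by simp))
    exact Measure.isFiniteMeasure_map _ _
  have hνtail : ∀ r, ν (Ioi r) = expNeg (D r) := by
    intro r
    rw [hν, Measure.map_apply hR measurableSet_Ioi, withDensity_apply _ (hR measurableSet_Ioi),
      ← lintegral_indicator (hR measurableSet_Ioi)]
    exact hX.lintegral_expNeg_of_lt_iInf hμ hδm hδ hF r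
  -- Differentiation of the tail exp(-D) gives the density ψ exp(-D), as D is a primitive of ψ.
  have hνeq : ν = volume.withDensity (fun r => ψ r * expNeg (D r)) := by
    refine Measure.ext_of_Ioc _ _ fun a b hab => ?_
    have hIoc : Ioc a b = Ioi a \ Ioi b := by ext; simp
    rw [withDensity_apply _ measurableSet_Ioc]
    have h2 : ν (Ioc a b) = expNeg (D a) - expNeg (D b) := by
      rw [hIoc, measure_sdiff (Ioi_subset_Ioi hab.le) measurableSet_Ioi.nullMeasurableSet
        (measure_ne_top _ _), hνtail, hνtail]
    have h3 : ∫⁻ r in Ioc a b, ψ r * expNeg (D r) =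
        ∫⁻ r in Ioc a b, expNeg (D a) * (ψ r * expNeg (∫⁻ s in Ioc a r, ψ s)) := by
      refine setLIntegral_congr_fun measurableSet_Ioc fun r hr => ?_
      rw [hD a r hr.1.le, expNeg_add]
      ring
    rw [h2, h3, lintegral_const_mul' _ _ (expNeg_ne_top _), lintegral_mul_expNeg_lintegral hψ hab.le
      (hψfin a b), hD a b hab.le, expNeg_add, ENNReal.mul_sub fun _ _ => expNeg_ne_top _, mul_one]
  -- The nearest point contributes the factor exp(-F(R)) to T. Finiteness of F makes this factor
  -- invertible, so it can be divided out. The same factor in ψ later cancels and leaves ℓ.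
  have hae : ∀ᵐ ω ∂P, G (R ω) *
      expNeg (∑' i, if i = nearest (fun i => δ (X i ω)) then 0 else F (δ (X i ω))) =
      G (R ω) * (expNeg (F (R ω)))⁻¹ * T ω := by
    filter_upwards [hX.ae_finite hμ hδ] with ω hω
    have hj := apply_nearest (exists_eq_iInf_of_finite (d := fun i => δ (X i ω))
      (fun i => (norm_nonneg _).trans (hδ _)) hω)
    have hTω : T ω = expNeg (F (R ω)) *
        expNeg (∑' i, if i = nearest (fun i => δ (X i ω)) then 0 else F (δ (X i ω))) := by
      rw [← expNeg_add, hTdef]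
      simp only
      rw [ENNReal.tsum_eq_add_tsum_ite (f := fun i => F (δ (X i ω)))
        (nearest (fun i => δ (X i ω))), hj]
      congr 2
      refine tsum_congr fun i => ?_
      split_ifs <;> rfl
    rw [hTω, mul_assoc, ← mul_assoc (expNeg (F (R ω)))⁻¹, ENNReal.inv_mul_cancel
        (fun h => hFtop _ (expNeg_eq_zero_iff.1 h)) (expNeg_ne_top _), one_mul]
  have hH : Measurable fun r => G r * (expNeg (F r))⁻¹ := hG.mul heF.inv
  rw [lintegral_congr_ae hae]
  calc ∫⁻ ω, G (R ω) * (expNeg (F (R ω)))⁻¹ * T ω ∂P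
      = ∫⁻ ω, G (R ω) * (expNeg (F (R ω)))⁻¹ ∂(P.withDensity T) := by
        refine Eq.trans ?_ (lintegral_withDensity_eq_lintegral_mul _ hT (hH.comp hR)).symm
        exact lintegral_congr fun ω => mul_comm _ _
    _ = ∫⁻ r, G r * (expNeg (F r))⁻¹ ∂ν := (lintegral_map hH hR).symm
    _ = ∫⁻ r, (ψ r * expNeg (D r)) * (G r * (expNeg (F r))⁻¹) := by
        rw [hνeq]
        exact lintegral_withDensity_eq_lintegral_mul _ (hψ.mul hDm) hH
    _ = ∫⁻ r, G r * (ℓ r * expNeg (D r)) := by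
        refine lintegral_congr fun r => ?_
        have hne : expNeg (F r) ≠ 0 := fun h => hFtop r (expNeg_eq_zero_iff.1 h)
        calc _ = (expNeg (F r) * (expNeg (F r))⁻¹) * (G r * (ℓ r * expNeg (D r))) := by
              simp only [hψdef]; ring
          _ = _ := by rw [ENNReal.mul_inv_cancel hne (expNeg_ne_top _), one_mul]

end NearestPoint

/-! ### Polar coordinates and radial intensities -/

lemma map_withDensity_comp {α β : Type*} [MeasurableSpace α] [MeasurableSpace β] {μ : Measure α}
    {f : α → β} (hf : Measurable f) {g : β → ℝ≥0∞} (hg : Measurable g) :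
    (μ.withDensity fun x => g (f x)).map f = (μ.map f).withDensity g := by
  ext s hs
  rw [Measure.map_apply hf hs, withDensity_apply _ (hf hs), withDensity_apply _ hs,
    setLIntegral_map hs hg hf]

lemma lintegral_Ioc_ofReal_id {h r : ℝ} (hh : 0 ≤ h) (hr : h ≤ r) :
    ∫⁻ t in Ioc h r, ENNReal.ofReal (2 * Real.pi * t) = ENNReal.ofReal (Real.pi * (r ^ 2 - h ^ 2)) := by
  rw [← ofReal_integral_eq_lintegral_ofReal, ← intervalIntegral.integral_of_le hr,
    intervalIntegral.integral_const_mul, integral_id]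
  · congr 1
    ring
  · exact (by fun_prop : Continuous fun t : ℝ => 2 * Real.pi * t).integrableOn_Ioc
  · refine (ae_restrict_iff' measurableSet_Ioc).2 (Eventually.of_forall fun t ht => ?_)
    have : 0 ≤ t := hh.trans ht.1.le
    simp only [Pi.zero_apply]
    positivity

lemma measurable_sqrt_norm_sq_add (h : ℝ) :
    Measurable fun x : Plane => Real.sqrt (‖x‖ ^ 2 + h ^ 2) := by fun_prop

/-- Polar coordinates: the distance to a point of a plane at height `h` has the density `2 π r`. -/
lemma map_sqrt_norm_sq_add_volume {h : ℝ} (hh : 0 ≤ h) :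
    (volume : Measure Plane).map (fun x => Real.sqrt (‖x‖ ^ 2 + h ^ 2)) =
      volume.withDensity (fun r => if h < r then ENNReal.ofReal (2 * Real.pi * r) else 0) := by
  have hm := measurable_sqrt_norm_sq_add h
  have hnn : ∀ x : Plane, h ≤ Real.sqrt (‖x‖ ^ 2 + h ^ 2) := fun x =>
    Real.le_sqrt_of_sq_le (by nlinarith [sq_nonneg ‖x‖])
  have hdm : Measurable fun r : ℝ => if h < r then ENNReal.ofReal (2 * Real.pi * r) else 0 :=
    Measurable.ite measurableSet_Ioi (by fun_prop) measurable_const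
  have hIic : ∀ r, h ≤ r → (volume : Measure Plane).map (fun x => Real.sqrt (‖x‖ ^ 2 + h ^ 2)) (Iic r) =
      ENNReal.ofReal (Real.pi * (r ^ 2 - h ^ 2)) := by
    intro r hr
    have h0 : 0 ≤ r ^ 2 - h ^ 2 := by nlinarith
    rw [Measure.map_apply hm measurableSet_Iic]
    have : (fun x : Plane => Real.sqrt (‖x‖ ^ 2 + h ^ 2)) ⁻¹' Iic r =
        Metric.closedBall 0 (Real.sqrt (r ^ 2 - h ^ 2)) := by
      ext x
      rw [mem_preimage, mem_Iic, mem_closedBall_zero_iff, Real.sqrt_le_left (hh.trans hr),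
        Real.le_sqrt (norm_nonneg x) h0]
      constructor <;> intro h <;> linarith
    rw [this, EuclideanSpace.volume_closedBall_fin_two, ← ENNReal.ofReal_pow (Real.sqrt_nonneg _),
      Real.sq_sqrt h0, mul_comm Real.pi, ENNReal.ofReal_mul h0]
  have hIic' : ∀ r, h ≤ r → (volume.withDensity
      (fun r : ℝ => if h < r then ENNReal.ofReal (2 * Real.pi * r) else 0)) (Iic r) =
      ENNReal.ofReal (Real.pi * (r ^ 2 - h ^ 2)) := by
    intro r hr
    rw [withDensity_apply _ measurableSet_Iic, ← lintegral_Ioc_ofReal_id hh hr,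
      ← lintegral_indicator measurableSet_Iic, ← lintegral_indicator measurableSet_Ioc]
    refine lintegral_congr fun t => ?_
    by_cases h1 : h < t <;> by_cases h2 : t ≤ r <;> simp [indicator, h1, h2]
  have heq : ∀ r, (volume : Measure Plane).map (fun x => Real.sqrt (‖x‖ ^ 2 + h ^ 2)) (Iic r) =
      (volume.withDensity
        (fun r : ℝ => if h < r then ENNReal.ofReal (2 * Real.pi * r) else 0)) (Iic r) ∧
      (volume : Measure Plane).map (fun x => Real.sqrt (‖x‖ ^ 2 + h ^ 2)) (Iic r) ≠ ⊤ := by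
    intro r
    by_cases hr : h ≤ r
    · rw [hIic r hr, hIic' r hr]
      exact ⟨rfl, ENNReal.ofReal_ne_top⟩
    · have h1 : (volume : Measure Plane).map (fun x => Real.sqrt (‖x‖ ^ 2 + h ^ 2)) (Iic r) = 0 := by
        rw [Measure.map_apply hm measurableSet_Iic]
        have : (fun x : Plane => Real.sqrt (‖x‖ ^ 2 + h ^ 2)) ⁻¹' Iic r = ∅ := by
          ext x
          simpa using (not_le.1 hr).trans_le (hnn x)
        rw [this, measure_empty]
      rw [h1]
      refine ⟨?_, ENNReal.zero_ne_top⟩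
      refine (le_antisymm ?_ zero_le).symm
      calc _ ≤ (volume.withDensity
            (fun r : ℝ => if h < r then ENNReal.ofReal (2 * Real.pi * r) else 0)) (Iic h) :=
            measure_mono (Iic_subset_Iic.2 (not_le.1 hr).le)
        _ = 0 := by rw [hIic' h le_rfl]; simp
  have hfin : ∀ a b : ℝ, (volume : Measure Plane).map (fun x => Real.sqrt (‖x‖ ^ 2 + h ^ 2)) (Ioc a b)
      ≠ ⊤ := fun a b => ne_top_of_le_ne_top (heq b).2 (measure_mono Ioc_subset_Iic_self)
  refine Measure.ext_of_Ioc' _ _ (fun a b _ => hfin a b) fun a b hab => ?_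
  have hIoc : Ioc a b = Iic b \ Iic a := by ext; simp [and_comm]
  rw [hIoc, measure_sdiff (Iic_subset_Iic.2 hab.le) measurableSet_Iic.nullMeasurableSet (heq a).2,
    measure_sdiff (Iic_subset_Iic.2 hab.le) measurableSet_Iic.nullMeasurableSet
      ((heq a).1 ▸ (heq a).2), (heq a).1, (heq b).1]

section Radial

variable {q : ℝ → ℝ} {lam h : ℝ}

/-- A rotationally symmetric intensity measure on the plane. -/
noncomputable def radialIntensity (lam : ℝ) (q : ℝ → ℝ) : Measure Plane :=
  volume.withDensity (fun x => ENNReal.ofReal (lam * q ‖x‖))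

/-- The density of the image of `radialIntensity lam q` under the distance from the height `h`. -/
noncomputable def radialDensity (lam : ℝ) (q : ℝ → ℝ) (h r : ℝ) : ℝ≥0∞ :=
  if h < r then ENNReal.ofReal (2 * Real.pi * r * (lam * q (Real.sqrt (r ^ 2 - h ^ 2)))) else 0

lemma measurable_radialDensity (hq : Measurable q) : Measurable (radialDensity lam q h) :=
  Measurable.ite measurableSet_Ioi (by fun_prop) measurable_const

/-- Local boundedness is the hypothesis under which ties between distances are excluded and the law
of the nearest distance is derived. -/
lemma radialDensity_le (hlam : 0 ≤ lam) (hh : 0 ≤ h) (hq1 : ∀ x, q x ≤ 1) (b : ℝ) :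
    ∃ K : ℝ≥0, ∀ t ≤ b, radialDensity lam q h t ≤ K := by
  refine ⟨(2 * Real.pi * b * lam).toNNReal, fun t ht => ?_⟩
  unfold radialDensity
  split_ifs with hr
  · refine ENNReal.ofReal_le_ofReal ?_
    have h0 : 0 ≤ t := hh.trans hr.le
    have h1 : lam * q (Real.sqrt (t ^ 2 - h ^ 2)) ≤ lam := by nlinarith [hq1 (Real.sqrt (t ^ 2 - h ^ 2))]
    calc 2 * Real.pi * t * (lam * q (Real.sqrt (t ^ 2 - h ^ 2))) ≤ 2 * Real.pi * t * lam := by gcongr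
      _ ≤ 2 * Real.pi * b * lam := by gcongr
  · exact zero_le

lemma map_radialIntensity (hh : 0 ≤ h) (hq : Measurable q) :
    (radialIntensity lam q).map (fun x => Real.sqrt (‖x‖ ^ 2 + h ^ 2)) =
      volume.withDensity (radialDensity lam q h) := by
  have hm := measurable_sqrt_norm_sq_add h
  have hg : Measurable fun r => ENNReal.ofReal (lam * q (Real.sqrt (r ^ 2 - h ^ 2))) := by fun_prop
  have h1 : radialIntensity lam q = volume.withDensity (fun x : Plane =>
      (fun r => ENNReal.ofReal (lam * q (Real.sqrt (r ^ 2 - h ^ 2))))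
        (Real.sqrt (‖x‖ ^ 2 + h ^ 2))) := by
    unfold radialIntensity
    congr 1
    ext x
    simp only
    rw [Real.sq_sqrt (by positivity), add_sub_cancel_right, Real.sqrt_sq (norm_nonneg _)]
  have hdm : Measurable fun r : ℝ => if h < r then ENNReal.ofReal (2 * Real.pi * r) else 0 :=
    Measurable.ite measurableSet_Ioi (by fun_prop) measurable_const
  rw [h1, map_withDensity_comp hm hg, map_sqrt_norm_sq_add_volume hh, ← withDensity_mul _ hdm hg]
  congr 1
  ext r
  simp only [Pi.mul_apply, radialDensity]
  split_ifs with hr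
  · have : 0 ≤ r := hh.trans hr.le
    rw [← ENNReal.ofReal_mul (by positivity)]
  · simp

lemma radialIntensity_closedBall_lt_top (hlam : 0 ≤ lam) (hq1 : ∀ x, q x ≤ 1) (r : ℝ) :
    radialIntensity lam q (Metric.closedBall 0 r) < ∞ := by
  rw [radialIntensity, withDensity_apply _ Metric.isClosed_closedBall.measurableSet]
  refine (lintegral_mono (g := fun _ => ENNReal.ofReal lam) fun x => ?_).trans_lt ?_
  · exact ENNReal.ofReal_le_ofReal (by nlinarith [hq1 ‖x‖])
  · simp only [lintegral_const, MeasurableSet.univ, Measure.restrict_apply, univ_inter]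
    exact ENNReal.mul_lt_top ENNReal.ofReal_lt_top measure_closedBall_lt_top

lemma intervalIntegrable_id_mul (hq : Measurable q) (hq0 : ∀ x, 0 ≤ q x) (hq1 : ∀ x, q x ≤ 1)
    (a b : ℝ) : IntervalIntegrable (fun x => x * q x) volume a b := by
  refine IntervalIntegrable.mono_fun (g := fun x => x * q x) (f := fun x : ℝ => x)
    (continuous_id'.intervalIntegrable a b) (by fun_prop) (Eventually.of_forall fun x => ?_)
  simp only [norm_mul, Real.norm_eq_abs, abs_of_nonneg (hq0 x)]
  exact mul_le_of_le_one_right (abs_nonneg _) (hq1 x)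

lemma map_radialIntensity_Iic (hlam : 0 ≤ lam) (hh : 0 ≤ h) (hq : Measurable q)
    (hq0 : ∀ x, 0 ≤ q x) (hq1 : ∀ x, q x ≤ 1) {r : ℝ} (hr : h ≤ r) :
    (radialIntensity lam q).map (fun x => Real.sqrt (‖x‖ ^ 2 + h ^ 2)) (Iic r) =
      ENNReal.ofReal (2 * Real.pi * lam * ∫ x in (0 : ℝ)..Real.sqrt (r ^ 2 - h ^ 2), x * q x) := by
  have h0 : 0 ≤ r ^ 2 - h ^ 2 := by nlinarith
  set s := Real.sqrt (r ^ 2 - h ^ 2) with hs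
  have hs0 : 0 ≤ s := Real.sqrt_nonneg _
  -- A point is within r of the user exactly when its horizontal distance is at most s. Passing to
  -- height 0 turns the integral into one over the horizontal distance, the form used in `densL` and
  -- `voidN`.
  have h1 : (radialIntensity lam q).map (fun x => Real.sqrt (‖x‖ ^ 2 + h ^ 2)) (Iic r) =
      (radialIntensity lam q).map (fun x => Real.sqrt (‖x‖ ^ 2 + 0 ^ 2)) (Iic s) := by
    rw [Measure.map_apply (measurable_sqrt_norm_sq_add h) measurableSet_Iic,
      Measure.map_apply (measurable_sqrt_norm_sq_add 0) measurableSet_Iic]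
    congr 1
    ext x
    have : (0 : ℝ) ^ 2 = 0 := by norm_num
    rw [mem_preimage, mem_preimage, mem_Iic, mem_Iic, this, add_zero, Real.sqrt_sq (norm_nonneg _),
      Real.sqrt_le_left (hh.trans hr), hs, Real.le_sqrt (norm_nonneg x) h0]
    constructor <;> intro h <;> linarith
  rw [h1, map_radialIntensity le_rfl hq, withDensity_apply _ measurableSet_Iic,
    ← intervalIntegral.integral_const_mul, intervalIntegral.integral_of_le hs0,
    ofReal_integral_eq_lintegral_ofReal]
  · rw [← lintegral_indicator measurableSet_Iic, ← lintegral_indicator measurableSet_Ioc]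
    refine lintegral_congr fun t => ?_
    by_cases h1 : 0 < t <;> by_cases h2 : t ≤ s <;> simp [indicator, h1, h2, radialDensity]
    rw [Real.sqrt_sq h1.le]
    congr 1
    ring
  · exact (((intervalIntegrable_id_mul hq hq0 hq1 0 s).const_mul _).1)
  · refine (ae_restrict_iff' measurableSet_Ioc).2 (Eventually.of_forall fun t ht => ?_)
    have := ht.1.le
    have := hq0 t
    simp only [Pi.zero_apply]
    positivity

end Radial

/-! ### Link distances and power comparison -/

namespace Params
variable (p : Params)

lemma probL_pos (x : ℝ) : 0 < p.probL x := by
  have := p.a_pos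
  unfold probL
  positivity

lemma probL_lt_one (x : ℝ) : p.probL x < 1 := by
  have := p.a_pos
  unfold probL
  rw [div_lt_one (by positivity)]
  have := mul_pos this (Real.exp_pos (-p.b *
    (180 / Real.pi * (if x = 0 then Real.pi / 2 else Real.arctan (p.h / x - p.c)) - p.d)))
  linarith

lemma measurable_probL : Measurable p.probL := by
  have : Measurable fun x : ℝ => if x = 0 then Real.pi / 2 else Real.arctan (p.h / x - p.c) :=
    Measurable.ite (measurableSet_singleton 0) measurable_const
      (Real.measurable_arctan.comp (by fun_prop))
  unfold probL
  fun_prop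

lemma probN_pos (x : ℝ) : 0 < p.probN x := sub_pos.2 (p.probL_lt_one x)

lemma probN_le_one (x : ℝ) : p.probN x ≤ 1 := sub_le_self _ (p.probL_pos x).le

lemma measurable_probN : Measurable p.probN := measurable_const.sub p.measurable_probL

lemma intensityT_eq : p.intensityT = radialIntensity p.lamT fun _ => 1 := by
  simp [intensityT, radialIntensity]

lemma measurable_dist3 : Measurable p.dist3 := measurable_sqrt_norm_sq_add p.h

lemma norm_le_dist3 (x : Plane) : ‖x‖ ≤ p.dist3 x :=
  Real.le_sqrt_of_sq_le (by nlinarith [sq_nonneg p.h])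

lemma h_le_dist3 (x : Plane) : p.h ≤ p.dist3 x :=
  Real.le_sqrt_of_sq_le (by nlinarith [sq_nonneg ‖x‖])

/-- Intensity of the distances to the LoS ABSs. -/
noncomputable def distDensL (r : ℝ) : ℝ≥0∞ := radialDensity p.lamA p.probL p.h r

lemma measurable_distDensL : Measurable p.distDensL := measurable_radialDensity p.measurable_probL

lemma map_dist3_intensityL : p.intensityL.map p.dist3 = volume.withDensity p.distDensL :=
  map_radialIntensity p.h_pos.le p.measurable_probL

lemma intensityL_closedBall_lt_top (r : ℝ) : p.intensityL (Metric.closedBall 0 r) < ∞ :=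
  radialIntensity_closedBall_lt_top p.lamA_pos.le (fun x => (p.probL_lt_one x).le) r

lemma intensityN_closedBall_lt_top (r : ℝ) : p.intensityN (Metric.closedBall 0 r) < ∞ :=
  radialIntensity_closedBall_lt_top p.lamA_pos.le p.probN_le_one r

lemma intensityT_closedBall_lt_top (r : ℝ) : p.intensityT (Metric.closedBall 0 r) < ∞ := by
  rw [intensityT_eq]
  exact radialIntensity_closedBall_lt_top p.lamT_pos.le (fun x => le_rfl) r

/-- The density of the nearest distance is the intensity at r times the probability that there is no
closer point. -/
lemma distDensL_mul_expNeg {r : ℝ} (hr : p.h < r) :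
    p.distDensL r * expNeg (p.intensityL.map p.dist3 (Iic r)) = ENNReal.ofReal (p.densL r) := by
  have h1 : p.intensityL.map p.dist3 (Iic r) = _ :=
    map_radialIntensity_Iic p.lamA_pos.le p.h_pos.le p.measurable_probL
      (fun x => (p.probL_pos x).le) (fun x => (p.probL_lt_one x).le) hr.le
  have h0 : 0 ≤ ∫ x in (0 : ℝ)..Real.sqrt (r ^ 2 - p.h ^ 2), x * p.probL x :=
    intervalIntegral.integral_nonneg (Real.sqrt_nonneg _) fun x hx =>
      mul_nonneg hx.1 (p.probL_pos x).le
  have hr0 : 0 < r := p.h_pos.trans hr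
  have := p.probL_pos (Real.sqrt (r ^ 2 - p.h ^ 2))
  have := p.lamA_pos
  rw [h1, expNeg_ofReal (by positivity), distDensL, radialDensity, if_pos hr,
    ← ENNReal.ofReal_mul (by positivity), densL]
  congr 2
  · ring
  · congr 1
    ring

lemma densL_pos {r : ℝ} (hr : p.h ≤ r) : 0 < p.densL r := by
  have hr0 : 0 < r := p.h_pos.trans_le hr
  have := p.probL_pos (Real.sqrt (r ^ 2 - p.h ^ 2))
  have := p.lamA_pos
  unfold densL
  positivity

lemma voidN_pos (r : ℝ) : 0 < p.voidN r := Real.exp_pos _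

/-- A link of length `s` is received more weakly than one of length `r` exactly when it is longer
than the critical distance. -/
lemma rpow_neg_lt_rpow_neg_iff {η η' α β r s : ℝ} (hη : 0 < η) (hη' : 0 < η') (hα : 0 < α)
    (hr : 0 < r) (hs : 0 < s) :
    η * s ^ (-α) < η' * r ^ (-β) ↔ (η / η') ^ (1 / α) * r ^ (β / α) < s := by
  have h1 : (η / η') ^ (1 / α) * r ^ (β / α) = (η / η' * r ^ β) ^ (1 / α) := by
    rw [Real.mul_rpow (by positivity) (by positivity), ← Real.rpow_mul hr.le]
    congr 2
    ring
  have h2 : (η / η' * r ^ β) ^ (1 / α) < s ↔ η / η' * r ^ β < s ^ α := by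
    rw [← Real.rpow_lt_rpow_iff (by positivity) hs.le hα, ← Real.rpow_mul (by positivity),
      one_div_mul_cancel hα.ne', Real.rpow_one]
  rw [h1, h2, Real.rpow_neg hs.le, Real.rpow_neg hr.le]
  have h3 : 0 < s ^ α := by positivity
  have h4 : 0 < r ^ β := by positivity
  rw [← div_eq_mul_inv, ← div_eq_mul_inv, div_lt_div_iff₀ h3 h4, div_mul_eq_mul_div,
    div_lt_iff₀ hη', mul_comm η' (s ^ α)]

lemma etaL_pos : 0 < p.etaL := mul_pos (mul_pos p.an_pos p.PA_pos) p.CL_pos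
lemma etaN_pos : 0 < p.etaN := mul_pos (mul_pos p.an_pos p.PA_pos) p.CN_pos
lemma etaT_pos : 0 < p.etaT := mul_pos (mul_pos p.GM_pos p.PT_pos) p.CT_pos

/-- The two threshold maps are increasing and inverse to each other. This identifies `lLh` and `lLT`
as the serving distances at which the NLoS threshold reaches h and the TBS threshold reaches `RB`.
-/
lemma rpow_le_iff_le_rpow {η η' α β r s : ℝ} (hη : 0 < η) (hη' : 0 < η') (hα : 0 < α)
    (hβ : 0 < β) (hr : 0 < r) (hs : 0 < s) :
    (η / η') ^ (1 / α) * r ^ (β / α) ≤ s ↔ r ≤ (η' / η) ^ (1 / β) * s ^ (α / β) := by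
  rw [← not_lt, ← not_lt, not_iff_not, ← rpow_neg_lt_rpow_neg_iff hη' hη hβ hs hr]
  have h1 : (η / η') ^ (1 / α) * r ^ (β / α) = (η / η' * r ^ β) ^ (1 / α) := by
    rw [Real.mul_rpow (by positivity) (by positivity), ← Real.rpow_mul hr.le]
    congr 2
    ring
  have h2 : s < (η / η' * r ^ β) ^ (1 / α) ↔ s ^ α < η / η' * r ^ β := by
    rw [← Real.rpow_lt_rpow_iff hs.le (by positivity) hα, ← Real.rpow_mul (by positivity),
      one_div_mul_cancel hα.ne', Real.rpow_one]
  rw [h1, h2, Real.rpow_neg hs.le, Real.rpow_neg hr.le]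
  have h3 : 0 < s ^ α := by positivity
  have h4 : 0 < r ^ β := by positivity
  rw [← div_eq_mul_inv, ← div_eq_mul_inv, div_lt_div_iff₀ h4 h3, div_mul_eq_mul_div,
    lt_div_iff₀ hη', mul_comm η' (s ^ α)]

end Params

/-! ### Joint laws: independence and uniqueness -/

lemma lintegral_indepFun {Ω α β : Type*} [MeasurableSpace Ω] [MeasurableSpace α]
    [MeasurableSpace β] {P : Measure Ω} [IsProbabilityMeasure P] {X : Ω → α} {Y : Ω → β}
    (hX : Measurable X) (hY : Measurable Y) (h : IndepFun X Y P) {Φ : α → β → ℝ≥0∞}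
    (hΦ : Measurable (Function.uncurry Φ)) :
    ∫⁻ ω, Φ (X ω) (Y ω) ∂P = ∫⁻ ω, ∫⁻ ω', Φ (X ω) (Y ω') ∂P ∂P := by
  have h1 : ∫⁻ ω, Φ (X ω) (Y ω) ∂P = ∫⁻ z, Function.uncurry Φ z ∂(P.map fun ω => (X ω, Y ω)) :=
    (lintegral_map hΦ (hX.prodMk hY)).symm
  have := Measure.isProbabilityMeasure_map (μ := P) hX.aemeasurable
  have := Measure.isProbabilityMeasure_map (μ := P) hY.aemeasurable
  rw [h1, (indepFun_iff_map_prod_eq_prod_map_map hX.aemeasurable hY.aemeasurable).1 h,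
    lintegral_prod _ hΦ.aemeasurable, lintegral_map hΦ.lintegral_prod_right' hX]
  refine lintegral_congr fun ω => ?_
  exact lintegral_map (hΦ.comp measurable_prodMk_left) hY

/-- It suffices to compare boxes A × B × C. For fixed A and B, both sides are finite measures of C
with the same Laplace transform at the natural numbers. -/
lemma measure_prod_ext_of_expNeg {μ ν : Measure (ℝ × ℝ × ℝ≥0∞)} [IsFiniteMeasure μ]
    (h : ∀ A B : Set ℝ, MeasurableSet A → MeasurableSet B → ∀ n : ℕ,
      ∫⁻ z in A ×ˢ B ×ˢ univ, expNeg z.2.2 ^ n ∂μ = ∫⁻ z in A ×ˢ B ×ˢ univ, expNeg z.2.2 ^ n ∂ν) :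
    μ = ν := by
  have hsnd : Measurable fun z : ℝ × ℝ × ℝ≥0∞ => z.2.2 := by fun_prop
  refine Measure.ext_prod₃ fun {A B C} hA hB hC => ?_
  have hAB : MeasurableSet (A ×ˢ B ×ˢ (univ : Set ℝ≥0∞)) := hA.prod (hB.prod MeasurableSet.univ)
  have h0 : μ (A ×ˢ B ×ˢ univ) = ν (A ×ˢ B ×ˢ univ) := by simpa using h A B hA hB 0
  -- Finiteness of ν is not assumed; on each strip it is inherited from μ through the case n = 0.
  have hfin : IsFiniteMeasure (ν.restrict (A ×ˢ B ×ˢ univ)) :=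
    ⟨by rw [Measure.restrict_apply_univ, ← h0]; exact measure_lt_top _ _⟩
  have heq : (μ.restrict (A ×ˢ B ×ˢ univ)).map (fun z => z.2.2) =
      (ν.restrict (A ×ˢ B ×ˢ univ)).map (fun z => z.2.2) := by
    refine measure_ext_of_lintegral_expNeg fun n => ?_
    rw [lintegral_map (measurable_expNeg.pow_const n) hsnd,
      lintegral_map (measurable_expNeg.pow_const n) hsnd]
    exact h A B hA hB n
  have hset : ∀ κ : Measure (ℝ × ℝ × ℝ≥0∞), κ (A ×ˢ B ×ˢ C) =
      (κ.restrict (A ×ˢ B ×ˢ univ)).map (fun z => z.2.2) C := by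
    intro κ
    rw [Measure.map_apply hsnd hC, Measure.restrict_apply (hsnd hC)]
    congr 1
    ext z
    simp only [mem_prod, mem_inter_iff, mem_preimage, mem_univ, and_true]
    tauto
  rw [hset μ, hset ν, heq]

/-! ### Integration over the channel gains -/

namespace Params
variable (p : Params)

lemma measurable_rxL (q : ℝ) : Measurable fun z : ℝ × ℝ => p.rxL q z.1 z.2 := by
  unfold rxL; fun_prop

lemma measurable_rxN : Measurable fun z : ℝ × ℝ => p.rxN z.1 z.2 := by
  unfold rxN; fun_prop

/-- The logarithmic Laplace transform, at `n`, of the interference power of a LoS ABS at the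
distance `t`. -/
noncomputable def logLapL (n : ℕ) (t : ℝ) : ℝ≥0∞ :=
  negLog (∫⁻ g, expNeg (n * p.rxL 1 t g) ∂(gammaMeasure p.mL p.mL))

/-- The logarithmic Laplace transform, at `n`, of the interference power of a NLoS ABS at the
distance `t`. -/
noncomputable def logLapN (n : ℕ) (t : ℝ) : ℝ≥0∞ :=
  negLog (∫⁻ g, expNeg (n * p.rxN t g) ∂(gammaMeasure p.mN p.mN))

instance : IsProbabilityMeasure (gammaMeasure p.mL p.mL) :=
  isProbabilityMeasure_gammaMeasure p.mL_pos p.mL_pos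

instance : IsProbabilityMeasure (gammaMeasure p.mN p.mN) :=
  isProbabilityMeasure_gammaMeasure p.mN_pos p.mN_pos

lemma measurable_logLapL (n : ℕ) : Measurable (p.logLapL n) := by
  refine measurable_negLog.comp (Measurable.lintegral_prod_right' (f := fun z : ℝ × ℝ =>
    expNeg (n * p.rxL 1 z.1 z.2)) ?_)
  exact measurable_expNeg.comp ((p.measurable_rxL 1).const_mul _)

lemma measurable_logLapN (n : ℕ) : Measurable (p.logLapN n) := by
  refine measurable_negLog.comp (Measurable.lintegral_prod_right' (f := fun z : ℝ × ℝ =>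
    expNeg (n * p.rxN z.1 z.2)) ?_)
  exact measurable_expNeg.comp (p.measurable_rxN.const_mul _)

/-- The transform is the mean of a strictly positive function, because the received power is finite,
and hence it is not 0. This allows the contribution of the nearest ABS to be divided out. -/
lemma logLapL_ne_top (n : ℕ) (t : ℝ) : p.logLapL n t ≠ ⊤ := by
  intro h
  have hle : ∫⁻ g, expNeg (n * p.rxL 1 t g) ∂(gammaMeasure p.mL p.mL) ≤ 1 :=
    (lintegral_mono fun ω => expNeg_le_one _).trans (by simp)
  have h1 : ∫⁻ g, expNeg (n * p.rxL 1 t g) ∂(gammaMeasure p.mL p.mL) = 0 := by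
    rw [← expNeg_negLog hle, ← logLapL, h, expNeg_top]
  have hm : Measurable fun g => expNeg (n * p.rxL 1 t g) :=
    measurable_expNeg.comp (((p.measurable_rxL 1).comp measurable_prodMk_left).const_mul _)
  rw [lintegral_eq_zero_iff hm] at h1
  obtain ⟨g, hg⟩ := h1.exists
  rw [Pi.zero_apply, expNeg_eq_zero_iff] at hg
  exact ENNReal.mul_ne_top (ENNReal.natCast_ne_top n) ENNReal.ofReal_ne_top hg

end Params

namespace Network

variable {p : Params} {Ω : Type*} [MeasurableSpace Ω] {P : Measure Ω} (M : Network p P)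

lemma measurable_XL : Measurable fun ω i => M.XL i ω := measurable_pi_lambda _ M.poissonL.measurable
lemma measurable_XN : Measurable fun ω i => M.XN i ω := measurable_pi_lambda _ M.poissonN.measurable
lemma measurable_XT : Measurable fun ω i => M.XT i ω := measurable_pi_lambda _ M.poissonT.measurable

lemma indepFun_XN_XT : IndepFun (fun ω i => M.XN i ω) (fun ω i => M.XT i ω) P :=
  M.indep_positions.indepFun (i := 1) (j := 2) (by decide)

lemma indepFun_XL_XN : IndepFun (fun ω i => M.XL i ω) (fun ω i => M.XN i ω) P :=
  M.indep_positions.indepFun (i := 0) (j := 1) (by decide)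

lemma measurable_RL : Measurable M.RL :=
  Measurable.iInf fun i => p.measurable_dist3.comp (M.poissonL.measurable i)
lemma measurable_RN : Measurable M.RN :=
  Measurable.iInf fun i => p.measurable_dist3.comp (M.poissonN.measurable i)
lemma measurable_RT : Measurable M.RT :=
  Measurable.iInf fun i => measurable_norm.comp (M.poissonT.measurable i)

lemma indepFun_XL : IndepFun (fun ω i => M.XL i ω) (fun ω => (fun i => M.XN i ω, fun i => M.XT i ω)) P := by
  have hm : ∀ k : Fin 3, Measurable fun (ω : Ω) (i : ℕ) => ![M.XL, M.XN, M.XT] k i ω := by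
    intro k
    fin_cases k
    exacts [M.measurable_XL, M.measurable_XN, M.measurable_XT]
  exact (M.indep_positions.indepFun_prodMk hm 1 2 0 (by decide) (by decide)).symm

/-- The LoS and NLoS gains are treated as a single independent family indexed by `ℕ ⊕ ℕ`, with the
positions frozen inside the weights. -/
lemma lintegral_gains_weights {wL wN : ℕ → ℝ → ℝ≥0∞} (hwL : ∀ i, Measurable (wL i))
    (hwN : ∀ i, Measurable (wN i)) :
    ∫⁻ ω, expNeg ((∑' i, wL i (M.HL i ω)) + ∑' i, wN i (M.HN i ω)) ∂P =
      expNeg ((∑' i, negLog (∫⁻ g, expNeg (wL i g) ∂(gammaMeasure p.mL p.mL))) +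
        ∑' i, negLog (∫⁻ g, expNeg (wN i g) ∂(gammaMeasure p.mN p.mN))) := by
  have hY : ∀ k : ℕ ⊕ ℕ, Measurable (Sum.elim M.HL M.HN k) := by
    rintro (i | i)
    exacts [M.measurable_HL i, M.measurable_HN i]
  have hw : ∀ k : ℕ ⊕ ℕ, Measurable (Sum.elim wL wN k) := by
    rintro (i | i)
    exacts [hwL i, hwN i]
  have h := lintegral_expNeg_tsum_of_iIndepFun hY M.indep_gains hw
  have hs : ∀ f : ℕ ⊕ ℕ → ℝ≥0∞, ∑' k, f k = (∑' i, f (Sum.inl i)) + ∑' i, f (Sum.inr i) :=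
    fun f => Summable.tsum_sum ENNReal.summable ENNReal.summable
  simp only [hs, Sum.elim_inl, Sum.elim_inr] at h
  rw [h]
  congr 2
  · refine tsum_congr fun i => congrArg negLog ?_
    rw [← M.law_HL i]
    exact (lintegral_map (measurable_expNeg.comp (hwL i)) (M.measurable_HL i)).symm
  · refine tsum_congr fun i => congrArg negLog ?_
    rw [← M.law_HN i]
    exact (lintegral_map (measurable_expNeg.comp (hwN i)) (M.measurable_HN i)).symm

/-- The indicator of B is encoded as a weight of the j-th link, ∞ off B and 0 on B. The general
formula for weights then also covers the serving gain, whose factor is the Gamma probability of B.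
-/
lemma lintegral_gains_serving (j n : ℕ) {B : Set ℝ} (hB : MeasurableSet B) (dL dN : ℕ → ℝ) :
    ∫⁻ ω, B.indicator 1 (M.HL j ω) * expNeg (n * ((∑' i, if i = j then 0 else
        p.rxL 1 (dL i) (M.HL i ω)) + ∑' i, p.rxN (dN i) (M.HN i ω))) ∂P =
      gammaMeasure p.mL p.mL B * (expNeg (∑' i, if i = j then 0 else p.logLapL n (dL i)) *
        expNeg (∑' i, p.logLapN n (dN i))) := by
  classical
  let wL : ℕ → ℝ → ℝ≥0∞ := fun i g =>
    if i = j then Bᶜ.indicator (fun _ => ⊤) g else n * p.rxL 1 (dL i) g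
  let wN : ℕ → ℝ → ℝ≥0∞ := fun i g => n * p.rxN (dN i) g
  have hwL : ∀ i, Measurable (wL i) := by
    intro i
    by_cases hi : i = j
    · simp only [wL, hi, if_true]
      exact measurable_const.indicator hB.compl
    · simp only [wL, hi, if_false]
      exact ((p.measurable_rxL 1).comp measurable_prodMk_left).const_mul _
  have hwN : ∀ i, Measurable (wN i) := fun i =>
    (p.measurable_rxN.comp measurable_prodMk_left).const_mul _
  have hexp : ∀ g, expNeg (wL j g) = B.indicator 1 g := by
    intro g
    by_cases hg : g ∈ B <;> simp [wL, hg]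
  have h := M.lintegral_gains_weights hwL hwN
  have hsplit : ∀ ω, ∑' i, wL i (M.HL i ω) = wL j (M.HL j ω) +
      ∑' i, n * (if i = j then 0 else p.rxL 1 (dL i) (M.HL i ω)) := by
    intro ω
    rw [ENNReal.tsum_eq_add_tsum_ite j]
    congr 1
    refine tsum_congr fun i => ?_
    by_cases hi : i = j <;> simp [wL, hi]
  have hsplit2 : ∑' i, negLog (∫⁻ g, expNeg (wL i g) ∂(gammaMeasure p.mL p.mL)) =
      negLog (gammaMeasure p.mL p.mL B) + ∑' i, if i = j then 0 else p.logLapL n (dL i) := by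
    rw [ENNReal.tsum_eq_add_tsum_ite j]
    congr 1
    · simp_rw [hexp]
      rw [lintegral_indicator_one hB]
    · refine tsum_congr fun i => ?_
      by_cases hi : i = j <;> simp [wL, hi, Params.logLapL]
  calc _ = ∫⁻ ω, expNeg ((∑' i, wL i (M.HL i ω)) + ∑' i, wN i (M.HN i ω)) ∂P := by
        refine lintegral_congr fun ω => ?_
        rw [hsplit, expNeg_add, expNeg_add, hexp, mul_assoc, ← expNeg_add, mul_add,
          ENNReal.tsum_mul_left, ENNReal.tsum_mul_left]
    _ = _ := by
        rw [h, hsplit2, expNeg_add, expNeg_add, expNeg_negLog prob_le_one, mul_assoc]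
        rfl

lemma lintegral_gains_of_lt (n : ℕ) (r s : ℝ) (dL dN : ℕ → ℝ) :
    ∫⁻ ω, expNeg (n * ((∑' i, if r < dL i then p.rxL 1 (dL i) (M.HL i ω) else 0) +
        ∑' i, if s < dN i then p.rxN (dN i) (M.HN i ω) else 0)) ∂P =
      expNeg (∑' i, if r < dL i then p.logLapL n (dL i) else 0) *
        expNeg (∑' i, if s < dN i then p.logLapN n (dN i) else 0) := by
  let wL : ℕ → ℝ → ℝ≥0∞ := fun i g => n * if r < dL i then p.rxL 1 (dL i) g else 0
  let wN : ℕ → ℝ → ℝ≥0∞ := fun i g => n * if s < dN i then p.rxN (dN i) g else 0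
  have hwL : ∀ i, Measurable (wL i) := by
    intro i
    refine Measurable.const_mul ?_ _
    split_ifs
    · exact (p.measurable_rxL 1).comp measurable_prodMk_left
    · exact measurable_const
  have hwN : ∀ i, Measurable (wN i) := by
    intro i
    refine Measurable.const_mul ?_ _
    split_ifs
    · exact p.measurable_rxN.comp measurable_prodMk_left
    · exact measurable_const
  have h := M.lintegral_gains_weights hwL hwN
  have h10 : negLog 1 = 0 := by rw [← expNeg_zero, negLog_expNeg]
  calc _ = ∫⁻ ω, expNeg ((∑' i, wL i (M.HL i ω)) + ∑' i, wN i (M.HN i ω)) ∂P := by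
        refine lintegral_congr fun ω => ?_
        rw [mul_add, ← ENNReal.tsum_mul_left, ← ENNReal.tsum_mul_left]
    _ = _ := by
        rw [h, expNeg_add]
        congr 1
        · refine congrArg expNeg (tsum_congr fun i => ?_)
          by_cases hi : r < dL i <;> simp [wL, hi, Params.logLapL, h10]
        · refine congrArg expNeg (tsum_congr fun i => ?_)
          by_cases hi : s < dN i <;> simp [wN, hi, Params.logLapN, h10]

end Network

/-! ### Association thresholds and void probabilities -/

namespace Params
variable (p : Params)

lemma measurable_powL : Measurable p.powL := by unfold powL; fun_prop
lemma measurable_powN : Measurable p.powN := by unfold powN; fun_prop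
lemma measurable_powT : Measurable p.powT :=
  Measurable.ite measurableSet_Iic (by fun_prop) measurable_const

lemma measurable_tauN : Measurable p.tauN :=
  Measurable.ite measurableSet_Iic measurable_const (by fun_prop)

lemma measurable_tauT : Measurable p.tauT := by unfold tauT; fun_prop

/-- Probability that no TBS is received more strongly than a LoS ABS at the distance `r`. -/
noncomputable def voidT (r : ℝ) : ℝ :=
  Real.exp (-Real.pi * p.lamT * (min p.RB (p.tauT r)) ^ 2)

lemma tauT_pos {r : ℝ} (hr : 0 < r) : 0 < p.tauT r := by
  have := p.etaL_pos
  have := p.etaT_pos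
  unfold tauT; positivity

lemma powL_pos {r : ℝ} (hr : 0 < r) : 0 < p.powL r := by
  have := p.etaL_pos
  unfold powL; positivity

/-- A TBS beyond `RB` has power 0 and never wins, so the threshold `tauT r` is capped at `RB`. -/
lemma powT_lt_powL_iff {r s : ℝ} (hr : 0 < r) (hs : 0 < s) :
    p.powT s < p.powL r ↔ min p.RB (p.tauT r) < s := by
  unfold powT
  split_ifs with h
  · rw [powL, rpow_neg_lt_rpow_neg_iff p.etaT_pos p.etaL_pos p.alT_pos hr hs, min_lt_iff]
    exact ⟨Or.inr, fun h' => h'.resolve_left (not_lt.2 h)⟩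
  · simp only [p.powL_pos hr, true_iff]
    exact min_lt_of_left_lt (not_le.1 h)

lemma le_lLh_iff {r : ℝ} (hr : 0 < r) :
    r ≤ p.lLh ↔ (p.etaN / p.etaL) ^ (1 / p.alN) * r ^ (p.alL / p.alN) ≤ p.h :=
  (rpow_le_iff_le_rpow p.etaN_pos p.etaL_pos p.alN_pos p.alL_pos hr p.h_pos).symm

lemma le_lLT_iff {r : ℝ} (hr : 0 < r) : r ≤ p.lLT ↔ p.tauT r ≤ p.RB :=
  (rpow_le_iff_le_rpow p.etaT_pos p.etaL_pos p.alT_pos p.alL_pos hr p.RB_pos).symm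

lemma h_le_tauN {r : ℝ} (hr : 0 < r) : p.h ≤ p.tauN r := by
  unfold tauN
  split_ifs with h
  · exact le_rfl
  · exact (not_le.1 (mt (p.le_lLh_iff hr).2 h)).le

/-- For r ≤ `lLh` the power threshold lies at or below h, so every NLoS distance above h exceeds it.
The strict inequality h < s matters, because there `tauN r = h`. -/
lemma powN_lt_powL_iff {r s : ℝ} (hr : 0 < r) (hs : p.h < s) :
    p.powN s < p.powL r ↔ p.tauN r < s := by
  rw [powN, powL, rpow_neg_lt_rpow_neg_iff p.etaN_pos p.etaL_pos p.alN_pos hr (p.h_pos.trans hs),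
    tauN]
  split_ifs with h
  · simp only [hs, iff_true]
    exact ((p.le_lLh_iff hr).1 h).trans_lt hs
  · rfl

lemma expNeg_map_dist3_intensityN {r : ℝ} (hr : 0 < r) :
    expNeg (p.intensityN.map p.dist3 (Iic (p.tauN r))) = ENNReal.ofReal (p.voidN r) := by
  have h1 : p.intensityN.map p.dist3 (Iic (p.tauN r)) = _ :=
    map_radialIntensity_Iic p.lamA_pos.le p.h_pos.le p.measurable_probN
      (fun x => (p.probN_pos x).le) p.probN_le_one (p.h_le_tauN hr)
  have h0 : 0 ≤ ∫ x in (0 : ℝ)..Real.sqrt (p.tauN r ^ 2 - p.h ^ 2), x * p.probN x :=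
    intervalIntegral.integral_nonneg (Real.sqrt_nonneg _) fun x hx =>
      mul_nonneg hx.1 (p.probN_pos x).le
  have := p.lamA_pos
  rw [h1, expNeg_ofReal (by positivity), voidN]
  congr 2
  ring

lemma map_dist3_intensityN_Iic_h : p.intensityN.map p.dist3 (Iic p.h) = 0 := by
  have h1 : p.intensityN.map p.dist3 (Iic p.h) = _ :=
    map_radialIntensity_Iic p.lamA_pos.le p.h_pos.le p.measurable_probN
      (fun x => (p.probN_pos x).le) p.probN_le_one le_rfl
  rw [h1]
  simp

lemma map_norm_intensityT_Iic {r : ℝ} (hr : 0 ≤ r) :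
    p.intensityT.map norm (Iic r) = ENNReal.ofReal (Real.pi * p.lamT * r ^ 2) := by
  have h1 := map_radialIntensity_Iic p.lamT_pos.le le_rfl (q := fun _ => 1) measurable_const
    (fun _ => zero_le_one) (fun _ => le_rfl) hr
  have hn : (fun x : Plane => Real.sqrt (‖x‖ ^ 2 + 0 ^ 2)) = norm := by
    ext x; simp
  rw [hn, ← intensityT_eq] at h1
  rw [h1]
  congr 1
  have : (0 : ℝ) ^ 2 = 0 := by norm_num
  simp only [mul_one, integral_id, this, sub_zero, Real.sqrt_sq hr]
  ring

end Params

/-- This splits the exponent of the Laplace functional on a void event: the first term gives the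
void probability, the second the transform of the interference from beyond r. -/
lemma lintegral_ite_one_add {ρ : Measure ℝ} (g : ℝ → ℝ≥0∞) (r : ℝ) :
    ∫⁻ t, (if t ≤ r then 1 else g t) ∂ρ = ρ (Iic r) + ∫⁻ t, (if t ≤ r then 0 else g t) ∂ρ := by
  rw [← lintegral_indicator_one measurableSet_Iic, ← lintegral_add_left
    (measurable_one.indicator measurableSet_Iic)]
  refine lintegral_congr fun t => ?_
  by_cases ht : t ≤ r <;> simp [ht]

namespace Params
variable (p : Params)

/-- Laplace transform, at `n`, of the interference from the LoS ABSs farther than `r`. -/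
noncomputable def lapL (n : ℕ) (r : ℝ) : ℝ≥0∞ :=
  expNeg (∫⁻ t, (if t ≤ r then 0 else 1 - expNeg (p.logLapL n t)) ∂(p.intensityL.map p.dist3))

/-- Laplace transform, at `n`, of the interference from the NLoS ABSs farther than `r`. -/
noncomputable def lapN (n : ℕ) (r : ℝ) : ℝ≥0∞ :=
  expNeg (∫⁻ t, (if t ≤ r then 0 else 1 - expNeg (p.logLapN n t)) ∂(p.intensityN.map p.dist3))

lemma measurable_lapN (n : ℕ) : Measurable (p.lapN n) := by
  refine Monotone.measurable fun r s hrs => expNeg_anti (lintegral_mono fun t => ?_)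
  by_cases hr : t ≤ r
  · simp [hr, hr.trans hrs]
  · by_cases hs : t ≤ s <;> simp [hr, hs]

lemma measurable_densL : Measurable p.densL := by
  have hc : Continuous fun s : ℝ => ∫ x in (0 : ℝ)..s, x * p.probL x :=
    intervalIntegral.continuous_primitive (fun a b => intervalIntegrable_id_mul p.measurable_probL
      (fun x => (p.probL_pos x).le) (fun x => (p.probL_lt_one x).le) a b) 0
  have h1 : Measurable fun r : ℝ => ∫ x in (0 : ℝ)..Real.sqrt (r ^ 2 - p.h ^ 2), x * p.probL x :=
    hc.measurable.comp (g := fun s : ℝ => ∫ x in (0 : ℝ)..s, x * p.probL x) (by fun_prop)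
  have h2 := p.measurable_probL
  unfold densL
  fun_prop

lemma measurable_voidN : Measurable p.voidN := by
  have hc : Continuous fun s : ℝ => ∫ x in (0 : ℝ)..s, x * p.probN x :=
    intervalIntegral.continuous_primitive (fun a b => intervalIntegrable_id_mul p.measurable_probN
      (fun x => (p.probN_pos x).le) p.probN_le_one a b) 0
  have h0 := p.measurable_tauN
  have h1 : Measurable fun r : ℝ => ∫ x in (0 : ℝ)..Real.sqrt (p.tauN r ^ 2 - p.h ^ 2), x * p.probN x :=
    hc.measurable.comp (g := fun s : ℝ => ∫ x in (0 : ℝ)..s, x * p.probN x) (by fun_prop)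
  unfold voidN
  fun_prop

lemma measurable_voidT : Measurable p.voidT := by
  have h0 := p.measurable_tauT
  unfold voidT
  fun_prop

/-- Density of the serving distance on the event of association with a LoS ABS. -/
noncomputable def assocDens (r : ℝ) : ℝ :=
  if p.h < r then p.densL r * (p.voidN r * p.voidT r) else 0

lemma measurable_assocDens : Measurable p.assocDens :=
  Measurable.ite measurableSet_Ioi
    (p.measurable_densL.mul (p.measurable_voidN.mul p.measurable_voidT)) measurable_const

lemma assocDens_nonneg (r : ℝ) : 0 ≤ p.assocDens r := by
  unfold assocDens
  split_ifs with hr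
  · exact mul_nonneg (p.densL_pos hr.le).le (mul_nonneg (p.voidN_pos r).le (Real.exp_pos _).le)
  · exact le_rfl

/-- Distance to the nearest ABS of a sequence of horizontal positions. -/
noncomputable def nearestDist (x : ℕ → Plane) : ℝ := ⨅ i, p.dist3 (x i)

/-- Index of the nearest ABS of a sequence of horizontal positions. -/
noncomputable def nearestIndex (x : ℕ → Plane) : ℕ := nearest fun i => p.dist3 (x i)

lemma measurable_dist3_seq : Measurable fun (x : ℕ → Plane) (i : ℕ) => p.dist3 (x i) :=
  measurable_pi_lambda _ fun i => p.measurable_dist3.comp (measurable_pi_apply i)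

lemma measurable_nearestDist : Measurable p.nearestDist :=
  measurable_iInf_seq.comp p.measurable_dist3_seq

lemma measurable_nearestIndex : Measurable p.nearestIndex :=
  measurable_nearest.comp p.measurable_dist3_seq

lemma h_le_nearestDist (x : ℕ → Plane) : p.h ≤ p.nearestDist x :=
  le_ciInf fun i => p.h_le_dist3 (x i)

end Params

/-! ### Integration over the positions -/

namespace Network

variable {p : Params} {Ω : Type*} [MeasurableSpace Ω] {P : Measure Ω} (M : Network p P)

/-- The index of the serving LoS ABS. -/
noncomputable def serving (ω : Ω) : ℕ := p.nearestIndex fun i => M.XL i ω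

lemma measurable_serving : Measurable M.serving := p.measurable_nearestIndex.comp M.measurable_XL

lemma h_le_RL (ω : Ω) : p.h ≤ M.RL ω := p.h_le_nearestDist _

lemma measurableSet_assocL : MeasurableSet M.assocL :=
  (measurableSet_lt (p.measurable_powN.comp M.measurable_RN)
    (p.measurable_powL.comp M.measurable_RL)).inter
  (measurableSet_lt (p.measurable_powT.comp M.measurable_RT)
    (p.measurable_powL.comp M.measurable_RL))

variable [IsProbabilityMeasure P]

/-- Almost surely no NLoS ABS is exactly overhead, as that set of positions has intensity 0. -/
lemma ae_h_lt_RN : ∀ᵐ ω ∂P, p.h < M.RN ω := by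
  have h := M.poissonN.measure_lt_iInf p.intensityN_closedBall_lt_top p.measurable_dist3
    p.norm_le_dist3 p.h
  rw [p.map_dist3_intensityN_Iic_h, expNeg_zero] at h
  exact (prob_compl_eq_zero_iff (measurableSet_lt measurable_const M.measurable_RN)).2 h

lemma ae_RT_pos : ∀ᵐ ω ∂P, 0 < M.RT ω := by
  have h := M.poissonT.measure_lt_iInf p.intensityT_closedBall_lt_top measurable_norm
    (fun _ => le_rfl) 0
  rw [p.map_norm_intensityT_Iic le_rfl] at h
  exact (prob_compl_eq_zero_iff (measurableSet_lt measurable_const M.measurable_RT)).2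
    (h.trans (by simp))

lemma measure_powT_lt {r : ℝ} (hr : 0 < r) :
    ∫⁻ ω, (if p.powT (M.RT ω) < p.powL r then 1 else 0) ∂P = ENNReal.ofReal (p.voidT r) := by
  have hm0 : 0 ≤ min p.RB (p.tauT r) := le_min p.RB_pos.le (p.tauT_pos hr).le
  have h := M.poissonT.measure_lt_iInf p.intensityT_closedBall_lt_top measurable_norm
    (fun _ => le_rfl) (min p.RB (p.tauT r))
  have hlam := p.lamT_pos
  rw [p.map_norm_intensityT_Iic hm0, expNeg_ofReal (by positivity)] at h
  have hv : ENNReal.ofReal (p.voidT r) = P {ω | min p.RB (p.tauT r) < M.RT ω} := by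
    refine Eq.trans ?_ h.symm
    rw [Params.voidT]
    congr 2
    ring
  rw [hv, ← lintegral_indicator_one (measurableSet_lt measurable_const M.measurable_RT)]
  refine lintegral_congr_ae ?_
  filter_upwards [M.ae_RT_pos] with ω hω
  simp [indicator, p.powT_lt_powL_iff hr hω]

lemma lintegral_powN_lt (n : ℕ) {r : ℝ} (hr : 0 < r) :
    ∫⁻ ω, (if p.powN (M.RN ω) < p.powL r then 1 else 0) *
        expNeg (∑' i, p.logLapN n (p.dist3 (M.XN i ω))) ∂P =
      ENNReal.ofReal (p.voidN r) * p.lapN n (p.tauN r) := by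
  have h := M.poissonN.lintegral_expNeg_of_lt_iInf p.intensityN_closedBall_lt_top
    p.measurable_dist3 p.norm_le_dist3 (p.measurable_logLapN n) (p.tauN r)
  rw [lintegral_ite_one_add, expNeg_add, p.expNeg_map_dist3_intensityN hr] at h
  refine Eq.trans (lintegral_congr_ae ?_) h
  filter_upwards [M.ae_h_lt_RN] with ω hω
  have : (p.powN (M.RN ω) < p.powL r) ↔ p.tauN r < ⨅ i, p.dist3 (M.XN i ω) :=
    p.powN_lt_powL_iff hr hω
  by_cases hc : p.tauN r < ⨅ i, p.dist3 (M.XN i ω) <;> simp [indicator, this, hc]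

lemma lintegral_association (n : ℕ) {r : ℝ} (hr : 0 < r) :
    ∫⁻ ω, (if p.powN (M.RN ω) < p.powL r ∧ p.powT (M.RT ω) < p.powL r then 1 else 0) *
        expNeg (∑' i, p.logLapN n (p.dist3 (M.XN i ω))) ∂P =
      ENNReal.ofReal (p.voidN r) * p.lapN n (p.tauN r) * ENNReal.ofReal (p.voidT r) := by
  rw [← M.lintegral_powN_lt n hr, ← M.measure_powT_lt hr]
  have hf : Measurable fun v : ℕ → Plane => (if p.powN (p.nearestDist v) < p.powL r then 1 else 0) *
        expNeg (∑' i, p.logLapN n (p.dist3 (v i))) := by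
    refine Measurable.mul ?_ (measurable_expNeg.comp (Measurable.tsum fun i =>
      (p.measurable_logLapN n).comp (p.measurable_dist3.comp (measurable_pi_apply i))))
    exact Measurable.ite (measurableSet_lt (p.measurable_powN.comp p.measurable_nearestDist)
      measurable_const) measurable_const measurable_const
  have hg : Measurable fun w : ℕ → Plane => if p.powT (⨅ i, ‖w i‖) < p.powL r then (1 : ℝ≥0∞) else 0 :=
    Measurable.ite (measurableSet_lt (p.measurable_powT.comp (Measurable.iInf fun i =>
      measurable_norm.comp (measurable_pi_apply i))) measurable_const) measurable_const
      measurable_const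
  have h := lintegral_mul_eq_lintegral_mul_lintegral_of_indepFun (hf.comp M.measurable_XN)
    (hg.comp M.measurable_XT) (M.indepFun_XN_XT.comp hf hg)
  refine Eq.trans (lintegral_congr fun ω => ?_) h
  change _ = ((if p.powN (M.RN ω) < p.powL r then 1 else 0) *
    expNeg (∑' i, p.logLapN n (p.dist3 (M.XN i ω)))) *
      (if p.powT (M.RT ω) < p.powL r then (1 : ℝ≥0∞) else 0)
  by_cases h1 : p.powN (M.RN ω) < p.powL r <;> by_cases h2 : p.powT (M.RT ω) < p.powL r <;>
    simp [h1, h2]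

/-- The gains are integrated first, which replaces each interferer by the weight `logLapL` or
`logLapN` of its distance. Independence of the LoS and NLoS positions and two applications of the
Laplace functional finish the computation. -/
lemma lintegral_expNeg_interferenceAt (n : ℕ) (r : ℝ) :
    ∫⁻ ω, expNeg (n * M.interferenceAt r ω) ∂P = p.lapL n r * p.lapN n (p.tauN r) := by
  have hL : ∀ i, Measurable fun z : ((ℕ → Plane) × (ℕ → Plane) × (ℕ → Plane)) ×
      ((ℕ → ℝ) × (ℕ → ℝ)) => p.dist3 (z.1.1 i) := fun i => p.measurable_dist3.comp (by fun_prop)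
  have hN : ∀ i, Measurable fun z : ((ℕ → Plane) × (ℕ → Plane) × (ℕ → Plane)) ×
      ((ℕ → ℝ) × (ℕ → ℝ)) => p.dist3 (z.1.2.1 i) := fun i => p.measurable_dist3.comp (by fun_prop)
  let Φ : ((ℕ → Plane) × (ℕ → Plane) × (ℕ → Plane)) → ((ℕ → ℝ) × (ℕ → ℝ)) → ℝ≥0∞ := fun x y =>
    expNeg (n * ((∑' i, if r < p.dist3 (x.1 i) then p.rxL 1 (p.dist3 (x.1 i)) (y.1 i) else 0) +
      ∑' i, if p.tauN r < p.dist3 (x.2.1 i) then p.rxN (p.dist3 (x.2.1 i)) (y.2 i) else 0))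
  have hΦ : Measurable (Function.uncurry Φ) := by
    refine measurable_expNeg.comp (Measurable.const_mul (Measurable.add ?_ ?_) _)
    · refine Measurable.tsum fun i => Measurable.ite (measurableSet_lt measurable_const (hL i)) ?_
        measurable_const
      exact (p.measurable_rxL 1).comp ((hL i).prodMk (by fun_prop))
    · refine Measurable.tsum fun i => Measurable.ite (measurableSet_lt measurable_const (hN i)) ?_
        measurable_const
      exact p.measurable_rxN.comp ((hN i).prodMk (by fun_prop))
  have h := lintegral_indepFun (M.measurable_XL.prodMk (M.measurable_XN.prodMk M.measurable_XT))
    ((measurable_pi_lambda _ M.measurable_HL).prodMk (measurable_pi_lambda _ M.measurable_HN))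
    M.indep_positions_gains hΦ
  refine h.trans ?_
  have h2 : ∀ ω, ∫⁻ ω', Φ (fun i => M.XL i ω, fun i => M.XN i ω, fun i => M.XT i ω)
      (fun i => M.HL i ω', fun i => M.HN i ω') ∂P = _ := fun ω =>
    M.lintegral_gains_of_lt n r (p.tauN r) (fun i => p.dist3 (M.XL i ω))
      (fun i => p.dist3 (M.XN i ω))
  simp_rw [h2]
  have hgL : Measurable fun x : Plane => if r < p.dist3 x then p.logLapL n (p.dist3 x) else 0 :=
    Measurable.ite (measurableSet_lt measurable_const p.measurable_dist3)
      ((p.measurable_logLapL n).comp p.measurable_dist3) measurable_const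
  have hgN : Measurable fun x : Plane => if p.tauN r < p.dist3 x then p.logLapN n (p.dist3 x) else 0 :=
    Measurable.ite (measurableSet_lt measurable_const p.measurable_dist3)
      ((p.measurable_logLapN n).comp p.measurable_dist3) measurable_const
  have hfL : Measurable fun u : ℕ → Plane => expNeg (∑' i,
      if r < p.dist3 (u i) then p.logLapL n (p.dist3 (u i)) else 0) :=
    measurable_expNeg.comp (Measurable.tsum fun i => hgL.comp (measurable_pi_apply i))
  have hfN : Measurable fun u : ℕ → Plane => expNeg (∑' i,
      if p.tauN r < p.dist3 (u i) then p.logLapN n (p.dist3 (u i)) else 0) :=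
    measurable_expNeg.comp (Measurable.tsum fun i => hgN.comp (measurable_pi_apply i))
  refine (lintegral_mul_eq_lintegral_mul_lintegral_of_indepFun (hfL.comp M.measurable_XL)
    (hfN.comp M.measurable_XN) (M.indepFun_XL_XN.comp hfL hfN)).trans ?_
  have h3 := M.poissonL.lintegral_expNeg_tsum p.intensityL_closedBall_lt_top hgL
  have h4 := M.poissonN.lintegral_expNeg_tsum p.intensityN_closedBall_lt_top hgN
  have hmL : Measurable fun t => if t ≤ r then (0 : ℝ≥0∞) else 1 - expNeg (p.logLapL n t) :=
    Measurable.ite measurableSet_Iic measurable_const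
      (measurable_const.sub (measurable_expNeg.comp (p.measurable_logLapL n)))
  have hmN : Measurable fun t => if t ≤ p.tauN r then (0 : ℝ≥0∞) else 1 - expNeg (p.logLapN n t) :=
    Measurable.ite measurableSet_Iic measurable_const
      (measurable_const.sub (measurable_expNeg.comp (p.measurable_logLapN n)))
  rw [Params.lapL, Params.lapN, lintegral_map hmL p.measurable_dist3,
    lintegral_map hmN p.measurable_dist3]
  congr 1
  · refine h3.trans (congrArg expNeg (lintegral_congr fun x => ?_))
    by_cases hx : r < p.dist3 x
    · simp [hx, not_le.2 hx]
    · simp [hx, not_lt.1 hx]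
  · refine h4.trans (congrArg expNeg (lintegral_congr fun x => ?_))
    by_cases hx : p.tauN r < p.dist3 x
    · simp [hx, not_le.2 hx]
    · simp [hx, not_lt.1 hx]

/-- The joint law of the serving distance, of the gain of the serving link and of the
interference on the event of association, expressed by its Laplace transform. -/
lemma lintegral_assocL (n : ℕ) {A B : Set ℝ} (hA : MeasurableSet A) (hB : MeasurableSet B) :
    ∫⁻ ω, M.assocL.indicator 1 ω * (A.indicator 1 (M.RL ω) *
        (B.indicator 1 (M.HL (M.serving ω) ω) *
          expNeg (n * M.interference (M.serving ω) ω))) ∂P =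
      gammaMeasure p.mL p.mL B * ∫⁻ r, A.indicator 1 r *
        (ENNReal.ofReal (p.assocDens r) * (p.lapL n r * p.lapN n (p.tauN r))) := by
  classical
  let a : (ℕ → Plane) → ((ℕ → Plane) × (ℕ → Plane)) → ℝ≥0∞ := fun u v =>
    if p.powN (p.nearestDist v.1) < p.powL (p.nearestDist u) ∧
      p.powT (⨅ i, ‖v.2 i‖) < p.powL (p.nearestDist u) then 1 else 0
  have ha : Measurable (Function.uncurry a) := by
    have h1 : Measurable fun z : (ℕ → Plane) × ((ℕ → Plane) × (ℕ → Plane)) =>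
        p.powL (p.nearestDist z.1) :=
      p.measurable_powL.comp (p.measurable_nearestDist.comp measurable_fst)
    have h2 : Measurable fun z : (ℕ → Plane) × ((ℕ → Plane) × (ℕ → Plane)) =>
        p.powN (p.nearestDist z.2.1) :=
      p.measurable_powN.comp (p.measurable_nearestDist.comp (by fun_prop))
    have h3 : Measurable fun z : (ℕ → Plane) × ((ℕ → Plane) × (ℕ → Plane)) =>
        p.powT (⨅ i, ‖z.2.2 i‖) :=
      p.measurable_powT.comp (Measurable.iInf fun i => by fun_prop)
    exact Measurable.ite ((measurableSet_lt h2 h1).inter (measurableSet_lt h3 h1)) measurable_const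
      measurable_const
  have ha_top : ∀ u v, a u v ≠ ⊤ := by
    intro u v
    simp only [a]
    split_ifs <;> simp
  have hA_top : ∀ r, A.indicator (1 : ℝ → ℝ≥0∞) r ≠ ⊤ := by
    intro r
    by_cases hr : r ∈ A <;> simp [hr]
  -- The integrand is written as a function of positions and gains, so that the gains can be
  -- integrated with the positions fixed. The index of the serving ABS is a function of the LoS
  -- positions alone.
  let Φ : ((ℕ → Plane) × (ℕ → Plane) × (ℕ → Plane)) → ((ℕ → ℝ) × (ℕ → ℝ)) → ℝ≥0∞ := fun x y =>
    a x.1 x.2 * (A.indicator 1 (p.nearestDist x.1) * (B.indicator 1 (y.1 (p.nearestIndex x.1)) *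
      expNeg (n * ((∑' i, if i = p.nearestIndex x.1 then 0 else
        p.rxL 1 (p.dist3 (x.1 i)) (y.1 i)) + ∑' i, p.rxN (p.dist3 (x.2.1 i)) (y.2 i)))))
  have hL : ∀ i, Measurable fun z : ((ℕ → Plane) × (ℕ → Plane) × (ℕ → Plane)) ×
      ((ℕ → ℝ) × (ℕ → ℝ)) => p.dist3 (z.1.1 i) := fun i => p.measurable_dist3.comp (by fun_prop)
  have hN : ∀ i, Measurable fun z : ((ℕ → Plane) × (ℕ → Plane) × (ℕ → Plane)) ×
      ((ℕ → ℝ) × (ℕ → ℝ)) => p.dist3 (z.1.2.1 i) := fun i => p.measurable_dist3.comp (by fun_prop)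
  have hJ : Measurable fun z : ((ℕ → Plane) × (ℕ → Plane) × (ℕ → Plane)) ×
      ((ℕ → ℝ) × (ℕ → ℝ)) => p.nearestIndex z.1.1 := p.measurable_nearestIndex.comp (by fun_prop)
  have hΦ : Measurable (Function.uncurry Φ) := by
    refine Measurable.mul (ha.comp measurable_fst) (Measurable.mul ?_ (Measurable.mul ?_ ?_))
    · exact (measurable_one.indicator hA).comp (p.measurable_nearestDist.comp (by fun_prop))
    · have : Measurable fun z : ℕ × (ℕ → ℝ) => z.2 z.1 :=
        measurable_from_prod_countable_right fun j => measurable_pi_apply j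
      exact (measurable_one.indicator hB).comp (this.comp (hJ.prodMk (by fun_prop)))
    · refine measurable_expNeg.comp (Measurable.const_mul (Measurable.add ?_ ?_) _)
      · refine Measurable.tsum fun i => Measurable.ite
          (measurableSet_eq_fun measurable_const hJ) measurable_const ?_
        exact (p.measurable_rxL 1).comp ((hL i).prodMk (by fun_prop))
      · exact Measurable.tsum fun i => p.measurable_rxN.comp ((hN i).prodMk (by fun_prop))
  have h := lintegral_indepFun (M.measurable_XL.prodMk (M.measurable_XN.prodMk M.measurable_XT))
    ((measurable_pi_lambda _ M.measurable_HL).prodMk (measurable_pi_lambda _ M.measurable_HN))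
    M.indep_positions_gains hΦ
  -- Up to the factor `gammaMeasure p.mL p.mL B`, this is what remains after the gains are
  -- integrated: a function of the LoS positions and of the NLoS and TBS positions.
  let Ψ : (ℕ → Plane) → ((ℕ → Plane) × (ℕ → Plane)) → ℝ≥0∞ := fun u v =>
    A.indicator 1 (p.nearestDist u) *
      expNeg (∑' i, if i = p.nearestIndex u then 0 else p.logLapL n (p.dist3 (u i))) *
      (a u v * expNeg (∑' i, p.logLapN n (p.dist3 (v.1 i))))
  have hΨ : Measurable (Function.uncurry Ψ) := by
    have hL' : ∀ i, Measurable fun z : (ℕ → Plane) × ((ℕ → Plane) × (ℕ → Plane)) =>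
        p.dist3 (z.1 i) := fun i => p.measurable_dist3.comp (by fun_prop)
    have hN' : ∀ i, Measurable fun z : (ℕ → Plane) × ((ℕ → Plane) × (ℕ → Plane)) =>
        p.dist3 (z.2.1 i) := fun i => p.measurable_dist3.comp (by fun_prop)
    refine Measurable.mul (Measurable.mul ?_ ?_) (ha.mul ?_)
    · exact (measurable_one.indicator hA).comp (p.measurable_nearestDist.comp (by fun_prop))
    · refine measurable_expNeg.comp (Measurable.tsum fun i => Measurable.ite
        (measurableSet_eq_fun measurable_const (p.measurable_nearestIndex.comp measurable_fst))
        measurable_const ?_)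
      exact (p.measurable_logLapL n).comp (hL' i)
    · exact measurable_expNeg.comp (Measurable.tsum fun i => (p.measurable_logLapN n).comp (hN' i))
  have h2 : ∀ ω, ∫⁻ ω', Φ (fun i => M.XL i ω, fun i => M.XN i ω, fun i => M.XT i ω)
      (fun i => M.HL i ω', fun i => M.HN i ω') ∂P = gammaMeasure p.mL p.mL B *
        Ψ (fun i => M.XL i ω) (fun i => M.XN i ω, fun i => M.XT i ω) := by
    intro ω
    simp only [Φ, Ψ]
    rw [lintegral_const_mul' _ _ (ha_top _ _), lintegral_const_mul' _ _ (hA_top _),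
      M.lintegral_gains_serving (p.nearestIndex fun i => M.XL i ω) n hB
        (fun i => p.dist3 (M.XL i ω)) (fun i => p.dist3 (M.XN i ω))]
    ring
  have h3 := lintegral_indepFun M.measurable_XL (M.measurable_XN.prodMk M.measurable_XT)
    M.indepFun_XL hΨ
  -- Integration over the NLoS and TBS positions leaves a function of the nearest LoS distance
  -- alone, which is the form required by `IsPoissonProcess.lintegral_nearest`.
  let G : ℝ → ℝ≥0∞ := fun r => A.indicator 1 r *
    (ENNReal.ofReal (p.voidN r) * p.lapN n (p.tauN r) * ENNReal.ofReal (p.voidT r))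
  have hG : Measurable G := (measurable_one.indicator hA).mul
    ((p.measurable_voidN.ennreal_ofReal.mul ((p.measurable_lapN n).comp p.measurable_tauN)).mul
      p.measurable_voidT.ennreal_ofReal)
  have h4 : ∀ ω, ∫⁻ ω', Ψ (fun i => M.XL i ω) (fun i => M.XN i ω', fun i => M.XT i ω') ∂P =
      G (M.RL ω) * expNeg (∑' i, if i = M.serving ω then 0 else
        p.logLapL n (p.dist3 (M.XL i ω))) := by
    intro ω
    simp only [Ψ]
    rw [lintegral_const_mul' _ _ (ENNReal.mul_ne_top (hA_top _) (expNeg_ne_top _))]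
    refine (congrArg _ (M.lintegral_association n (p.h_pos.trans_le (M.h_le_RL ω)))).trans ?_
    change A.indicator 1 (M.RL ω) * expNeg (∑' i, if i = M.serving ω then 0 else
        p.logLapL n (p.dist3 (M.XL i ω))) * _ = _
    simp only [G]
    ring
  have h5 := M.poissonL.lintegral_nearest p.intensityL_closedBall_lt_top p.measurable_dist3
    p.norm_le_dist3 p.measurable_distDensL p.map_dist3_intensityL
    (radialDensity_le p.lamA_pos.le p.h_pos.le fun x => (p.probL_lt_one x).le)
    (p.measurable_logLapL n) (p.logLapL_ne_top n) hG
  calc _ = ∫⁻ ω, Φ (fun i => M.XL i ω, fun i => M.XN i ω, fun i => M.XT i ω)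
          (fun i => M.HL i ω, fun i => M.HN i ω) ∂P := by
        refine lintegral_congr fun ω => ?_
        have : M.assocL.indicator 1 ω = a (fun i => M.XL i ω)
            (fun i => M.XN i ω, fun i => M.XT i ω) := by
          by_cases hω : ω ∈ M.assocL
          · rw [indicator_of_mem hω]
            exact (if_pos hω).symm
          · rw [indicator_of_notMem hω]
            exact (if_neg hω).symm
        rw [this]
        rfl
    _ = gammaMeasure p.mL p.mL B * ∫⁻ ω, Ψ (fun i => M.XL i ω)
          (fun i => M.XN i ω, fun i => M.XT i ω) ∂P := by
        rw [h]
        simp_rw [h2]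
        exact lintegral_const_mul' _ _ (measure_ne_top _ _)
    _ = _ := by
        congr 1
        rw [h3]
        simp_rw [h4]
        refine h5.trans (lintegral_congr fun r => ?_)
        simp only [G]
        by_cases hr : p.h < r
        · rw [lintegral_ite_one_add, expNeg_add, ← mul_assoc (p.distDensL r),
            p.distDensL_mul_expNeg hr, Params.assocDens, if_pos hr,
            ENNReal.ofReal_mul (p.densL_pos hr.le).le, ENNReal.ofReal_mul (p.voidN_pos r).le,
            Params.lapL]
          ring
        · have h0 : p.distDensL r = 0 := if_neg hr
          rw [h0, Params.assocDens, if_neg hr]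
          simp

end Network

/-! ### Serving-distance densities and success outcomes -/

namespace Params
variable (p : Params)

lemma voidN_eq_one {r : ℝ} (hr : r ≤ p.lLh) : p.voidN r = 1 := by
  simp [voidN, tauN, hr]

lemma voidT_of_le {r : ℝ} (hr : 0 < r) (hr' : r ≤ p.lLT) :
    p.voidT r = Real.exp (-Real.pi * p.lamT * p.tauT r ^ 2) := by
  rw [voidT, min_eq_right ((p.le_lLT_iff hr).1 hr')]

lemma voidT_of_lt {r : ℝ} (hr : 0 < r) (hr' : p.lLT < r) : p.voidT r = 1 - p.QT := by
  have h := (p.le_lLT_iff hr).not.1 (not_le.2 hr')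
  rw [voidT, min_eq_left (not_le.1 h).le, QT, sub_sub_cancel]

lemma one_sub_QT_le {r : ℝ} (hr : 0 < r) (hr' : r ≤ p.lLT) :
    1 - p.QT ≤ Real.exp (-Real.pi * p.lamT * p.tauT r ^ 2) := by
  have h := (p.le_lLT_iff hr).1 hr'
  have h1 := (p.tauT_pos hr).le
  have h2 := p.lamT_pos
  rw [QT, sub_sub_cancel, Real.exp_le_exp]
  have h3 : p.tauT r ^ 2 ≤ p.RB ^ 2 := by gcongr
  have h4 : 0 ≤ Real.pi * p.lamT := by positivity
  nlinarith

/-- The outcomes (serving distance, gain of the serving link, interference) for which decoding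
succeeds. -/
def successSet (ef et : ℝ) : Set (ℝ × ℝ × ℝ≥0∞) :=
  {z | (z.1 ≤ p.Rf ∧ p.NearSuccess ef et z.1 z.2.1 z.2.2) ∨ (p.Rf < z.1 ∧ p.FarSuccess et z.1 z.2.1 z.2.2)}

lemma measurable_rxL_comp (q : ℝ) :
    Measurable fun z : ℝ × ℝ × ℝ≥0∞ => p.rxL q z.1 z.2.1 :=
  (p.measurable_rxL q).comp (by fun_prop : Measurable fun z : ℝ × ℝ × ℝ≥0∞ => (z.1, z.2.1))

lemma measurableSet_nearSuccess (ef et : ℝ) :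
    MeasurableSet {z : ℝ × ℝ × ℝ≥0∞ | p.NearSuccess ef et z.1 z.2.1 z.2.2} := by
  have h := p.measurable_rxL_comp
  have h1 : Measurable fun z : ℝ × ℝ × ℝ≥0∞ => p.sinrNearFixed z.1 z.2.1 z.2.2 :=
    (h _).div (((h _).add (by fun_prop)).add measurable_const)
  have h2 : Measurable fun z : ℝ × ℝ × ℝ≥0∞ => p.sinrNearOwn z.1 z.2.1 z.2.2 :=
    (h _).div (Measurable.add (Measurable.add (by fun_prop) measurable_const) (h _))
  exact (measurableSet_lt measurable_const h1).inter (measurableSet_lt measurable_const h2)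

lemma measurableSet_farSuccess (et : ℝ) :
    MeasurableSet {z : ℝ × ℝ × ℝ≥0∞ | p.FarSuccess et z.1 z.2.1 z.2.2} := by
  have h := p.measurable_rxL_comp
  have h1 : Measurable fun z : ℝ × ℝ × ℝ≥0∞ => p.sinrFar z.1 z.2.1 z.2.2 :=
    (h _).div (((h _).add (by fun_prop)).add measurable_const)
  exact measurableSet_lt measurable_const h1

lemma measurableSet_successSet (ef et : ℝ) : MeasurableSet (p.successSet ef et) :=
  ((measurableSet_le measurable_fst measurable_const).inter (p.measurableSet_nearSuccess ef et)).union
    ((measurableSet_lt measurable_const measurable_fst).inter (p.measurableSet_farSuccess et))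

end Params

namespace Network

variable {p : Params} {Ω : Type*} [MeasurableSpace Ω] {P : Measure Ω} (M : Network p P)

lemma measurable_interference (j : ℕ) : Measurable (M.interference j) := by
  refine Measurable.add (Measurable.tsum fun i => ?_) (Measurable.tsum fun i => ?_)
  · split_ifs
    · exact measurable_const
    · exact (p.measurable_rxL 1).comp
        ((p.measurable_dist3.comp (M.poissonL.measurable i)).prodMk (M.measurable_HL i))
  · exact p.measurable_rxN.comp
      ((p.measurable_dist3.comp (M.poissonN.measurable i)).prodMk (M.measurable_HN i))

lemma measurable_interferenceAt : Measurable fun z : ℝ × Ω => M.interferenceAt z.1 z.2 := by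
  have hL : ∀ i, Measurable fun z : ℝ × Ω => p.dist3 (M.XL i z.2) := fun i =>
    p.measurable_dist3.comp ((M.poissonL.measurable i).comp measurable_snd)
  have hN : ∀ i, Measurable fun z : ℝ × Ω => p.dist3 (M.XN i z.2) := fun i =>
    p.measurable_dist3.comp ((M.poissonN.measurable i).comp measurable_snd)
  refine Measurable.add (Measurable.tsum fun i => ?_) (Measurable.tsum fun i => ?_)
  · refine Measurable.ite (measurableSet_lt measurable_fst (hL i)) ?_ measurable_const
    exact (p.measurable_rxL 1).comp ((hL i).prodMk ((M.measurable_HL i).comp measurable_snd))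
  · refine Measurable.ite (measurableSet_lt (p.measurable_tauN.comp measurable_fst) (hN i)) ?_
      measurable_const
    exact p.measurable_rxN.comp ((hN i).prodMk ((M.measurable_HN i).comp measurable_snd))

/-- The serving distance, the gain of the serving link and the interference. -/
noncomputable def link (ω : Ω) : ℝ × ℝ × ℝ≥0∞ :=
  (M.RL ω, M.HL (M.serving ω) ω, M.interference (M.serving ω) ω)

lemma measurable_link : Measurable M.link := by
  have h1 : Measurable fun z : ℕ × Ω => M.HL z.1 z.2 :=
    measurable_from_prod_countable_right fun j => M.measurable_HL j
  have h2 : Measurable fun z : ℕ × Ω => M.interference z.1 z.2 :=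
    measurable_from_prod_countable_right fun j => M.measurable_interference j
  have h3 : Measurable fun ω => (M.serving ω, ω) := M.measurable_serving.prodMk measurable_id
  exact M.measurable_RL.prodMk ((h1.comp h3).prodMk (h2.comp h3))

/-- The serving distance, gain and interference as functions of a distance, an independent gain
and the network. -/
noncomputable def virtualLink (z : ℝ × ℝ × Ω) : ℝ × ℝ × ℝ≥0∞ :=
  (z.1, z.2.1, M.interferenceAt z.1 z.2.2)

lemma measurable_virtualLink : Measurable M.virtualLink :=
  measurable_fst.prodMk ((by fun_prop : Measurable fun z : ℝ × ℝ × Ω => z.2.1).prodMk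
    (M.measurable_interferenceAt.comp (by fun_prop : Measurable fun z : ℝ × ℝ × Ω => (z.1, z.2.2))))

lemma measurable_servDens (i : Fin 2) : Measurable (M.servDens i) := by
  have h1 := p.measurable_densL
  have h2 := p.measurable_voidN
  have h3 := p.measurable_tauT
  fin_cases i
  · exact Measurable.ite measurableSet_Iio measurable_const (Measurable.ite measurableSet_Iic
      (by fun_prop) (by fun_prop))
  · refine Measurable.ite (measurableSet_Iio.union measurableSet_Ioi) measurable_const
      (Measurable.ite ((MeasurableSet.const _).union measurableSet_Iic) (by fun_prop) (by fun_prop))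

/-- For r ≤ `lLT` the terms 1 - `QT` cancel and the TBS void probability at `tauT r` remains. Beyond
`lLT` only the first density is present, and 1 - `QT` is itself the void probability. The branches
without `voidN` occur only where r ≤ `lLh`, where `voidN` is 1. -/
lemma servDens_add {r : ℝ} (hr : p.h < r) :
    M.servDens 0 r + M.servDens 1 r = p.assocDens r / M.probAssocL := by
  have hr0 : 0 < r := p.h_pos.trans hr
  have h1 : M.servDens 0 r = p.densL r / M.probAssocL * p.voidN r * (1 - p.QT) := by
    change M.servDens1 r = _
    rw [servDens1, if_neg (not_lt.2 hr.le)]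
    split_ifs with h
    · rw [p.voidN_eq_one h, mul_one]
    · rfl
  rw [h1, Params.assocDens, if_pos hr]
  change _ + M.servDens2 r = _
  rw [servDens2]
  by_cases hT : p.lLT < r
  · rw [if_pos (Or.inr hT), p.voidT_of_lt hr0 hT]
    ring
  · have hT' := not_lt.1 hT
    rw [if_neg (not_or.2 ⟨not_lt.2 hr.le, hT⟩), p.voidT_of_le hr0 hT']
    split_ifs with h
    · have : r ≤ p.lLh := h.elim (fun h => hT'.trans h.le) id
      rw [p.voidN_eq_one this]
      ring
    · ring

/-! ### Joint law of the serving link and coverage -/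

variable [IsProbabilityMeasure P]

/-- The joint law of the serving distance, gain and interference on the event of association. -/
theorem map_link_eq : (P.restrict M.assocL).map M.link =
    ((volume.withDensity fun r => ENNReal.ofReal (p.assocDens r)).prod
      ((gammaMeasure p.mL p.mL).prod P)).map M.virtualLink := by
  have hκ : Measurable fun r => ENNReal.ofReal (p.assocDens r) := p.measurable_assocDens.ennreal_ofReal
  have : IsFiniteMeasure ((P.restrict M.assocL).map M.link) := Measure.isFiniteMeasure_map _ _
  refine measure_prod_ext_of_expNeg fun A B hA hB n => ?_
  have hAB : MeasurableSet (A ×ˢ B ×ˢ (univ : Set ℝ≥0∞)) := hA.prod (hB.prod MeasurableSet.univ)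
  have hf : Measurable fun z : ℝ × ℝ × ℝ≥0∞ => A.indicator 1 z.1 * (B.indicator 1 z.2.1 *
      expNeg (n * z.2.2)) :=
    ((measurable_one.indicator hA).comp measurable_fst).mul
      (((measurable_one.indicator hB).comp (by fun_prop)).mul
        (measurable_expNeg.comp (by fun_prop)))
  have hset : ∀ κ : Measure (ℝ × ℝ × ℝ≥0∞), ∫⁻ z in A ×ˢ B ×ˢ univ, expNeg z.2.2 ^ n ∂κ =
      ∫⁻ z, A.indicator 1 z.1 * (B.indicator 1 z.2.1 * expNeg (n * z.2.2)) ∂κ := by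
    intro κ
    rw [← lintegral_indicator hAB]
    refine lintegral_congr fun z => ?_
    rw [expNeg_nsmul]
    by_cases h1 : z.1 ∈ A <;> by_cases h2 : z.2.1 ∈ B <;> simp [indicator, h1, h2]
  -- This evaluates the left side; on the right, Fubini factors out the Gamma probability of B and
  -- the transform of `interferenceAt r`, with the same result.
  have h0 := M.lintegral_assocL n hA hB
  rw [hset, hset, lintegral_map hf M.measurable_link, lintegral_map hf M.measurable_virtualLink]
  calc _ = ∫⁻ ω, M.assocL.indicator 1 ω * (A.indicator 1 (M.RL ω) *
        (B.indicator 1 (M.HL (M.serving ω) ω) *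
          expNeg (n * M.interference (M.serving ω) ω))) ∂P := by
        rw [← lintegral_indicator M.measurableSet_assocL]
        refine lintegral_congr fun ω => ?_
        by_cases hω : ω ∈ M.assocL <;> simp [hω, link]
    _ = _ := by
        refine h0.trans (Eq.symm ?_)
        refine (lintegral_prod _ (hf.comp M.measurable_virtualLink).aemeasurable).trans ?_
        refine (lintegral_withDensity_eq_lintegral_mul _ hκ
          (hf.comp M.measurable_virtualLink).lintegral_prod_right').trans ?_
        rw [← lintegral_const_mul' _ _ (measure_ne_top _ _)]
        refine lintegral_congr fun r => ?_
        have hA_top : A.indicator (1 : ℝ → ℝ≥0∞) r ≠ ⊤ := by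
          by_cases hr : r ∈ A <;> simp [hr]
        have hI : Measurable fun ω => expNeg (n * M.interferenceAt r ω) :=
          measurable_expNeg.comp ((M.measurable_interferenceAt.comp measurable_prodMk_left).const_mul _)
        simp only [Pi.mul_apply, Function.comp_apply, virtualLink]
        rw [lintegral_const_mul' _ _ hA_top,
          lintegral_prod_mul (f := fun g => B.indicator 1 g)
            (g := fun ω => expNeg (n * M.interferenceAt r ω))
            (measurable_one.indicator hB).aemeasurable hI.aemeasurable,
          lintegral_indicator_one hB, M.lintegral_expNeg_interferenceAt n r]
        ring

/-- Coverage probability at a given serving distance, in the near or in the far case. -/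
noncomputable def covAt (ef et r : ℝ) : ℝ := if r ≤ p.Rf then M.covNear ef et r else M.covFar et r

lemma measure_prod_successSet (ef et r : ℝ) :
    ((gammaMeasure p.mL p.mL).prod P) {y | (r, y.1, M.interferenceAt r y.2) ∈ p.successSet ef et} =
      ENNReal.ofReal (M.covAt ef et r) := by
  unfold covAt
  split_ifs with hr
  · rw [covNear, ofReal_measureReal]
    congr 1
    ext y
    simp [Params.successSet, hr, not_lt.2 hr]
  · rw [covFar, ofReal_measureReal]
    congr 1
    ext y
    simp [Params.successSet, hr, not_le.1 hr]

lemma measurable_measure_virtualLink {S : Set (ℝ × ℝ × ℝ≥0∞)} (hS : MeasurableSet S) :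
    Measurable fun r => ((gammaMeasure p.mL p.mL).prod P)
      {y | (r, y.1, M.interferenceAt r y.2) ∈ S} :=
  measurable_measure_prodMk_left (ν := (gammaMeasure p.mL p.mL).prod P)
    (M.measurable_virtualLink hS)

lemma measurable_covNear (ef et : ℝ) : Measurable (M.covNear ef et) :=
  (M.measurable_measure_virtualLink (p.measurableSet_nearSuccess ef et)).ennreal_toReal

lemma measurable_covFar (et : ℝ) : Measurable (M.covFar et) :=
  (M.measurable_measure_virtualLink (p.measurableSet_farSuccess et)).ennreal_toReal

lemma measurable_covAt (ef et : ℝ) : Measurable (M.covAt ef et) :=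
  Measurable.ite measurableSet_Iic (M.measurable_covNear ef et) (M.measurable_covFar et)

lemma covNear_mem (ef et r : ℝ) : M.covNear ef et r ∈ Icc 0 1 :=
  ⟨measureReal_nonneg, measureReal_le_one⟩

lemma covFar_mem (et r : ℝ) : M.covFar et r ∈ Icc 0 1 :=
  ⟨measureReal_nonneg, measureReal_le_one⟩

lemma measure_assocL_inter_link {S : Set (ℝ × ℝ × ℝ≥0∞)} (hS : MeasurableSet S) :
    P (M.assocL ∩ M.link ⁻¹' S) = ∫⁻ r, ENNReal.ofReal (p.assocDens r) *
      ((gammaMeasure p.mL p.mL).prod P) {y | (r, y.1, M.interferenceAt r y.2) ∈ S} := by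
  have hκ : Measurable fun r => ENNReal.ofReal (p.assocDens r) := p.measurable_assocDens.ennreal_ofReal
  rw [inter_comm, ← Measure.restrict_apply (M.measurable_link hS),
    ← Measure.map_apply M.measurable_link hS, M.map_link_eq,
    Measure.map_apply M.measurable_virtualLink hS,
    Measure.prod_apply (M.measurable_virtualLink hS)]
  exact lintegral_withDensity_eq_lintegral_mul _ hκ
    (measurable_measure_prodMk_left (M.measurable_virtualLink hS))

lemma measure_assocL : P M.assocL = ∫⁻ r, ENNReal.ofReal (p.assocDens r) := by
  have h := M.measure_assocL_inter_link (S := univ) MeasurableSet.univ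
  simpa using h

/-- The total mass of the density is the association probability, hence finite. This is why the
network itself enters a statement about a deterministic function. -/
lemma integrable_assocDens (M : Network p P) : Integrable p.assocDens := by
  refine ⟨p.measurable_assocDens.aestronglyMeasurable, ?_⟩
  rw [hasFiniteIntegral_iff_ofReal (Eventually.of_forall p.assocDens_nonneg), ← M.measure_assocL]
  exact measure_lt_top _ _

/-- The density is strictly positive on (h, ∞), a set of positive length, so its integral cannot
vanish. -/
lemma probAssocL_pos : 0 < M.probAssocL := by
  refine measureReal_nonneg.lt_of_ne' fun h => ?_
  have h1 : P M.assocL = 0 := (measureReal_eq_zero_iff).1 h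
  rw [M.measure_assocL, lintegral_eq_zero_iff p.measurable_assocDens.ennreal_ofReal] at h1
  have h2 : volume (Ioi p.h) = 0 := by
    refine measure_mono_null (fun r hr => ?_) h1
    have hr' : p.h < r := hr
    change ¬ (ENNReal.ofReal (p.assocDens r) = 0)
    rw [ENNReal.ofReal_eq_zero, not_le, Params.assocDens, if_pos hr']
    exact mul_pos (p.densL_pos hr'.le) (mul_pos (p.voidN_pos r) (Real.exp_pos _))
  simp at h2

/-- The event `success` allows any index that attains the nearest distance. Almost surely the
distances are pairwise distinct and the infimum is attained, so this index is `serving`. -/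
lemma ae_mem_success_iff (ef et : ℝ) :
    ∀ᵐ ω ∂P, ω ∈ M.success ef et ↔ M.link ω ∈ p.successSet ef et := by
  filter_upwards [M.poissonL.ae_finite p.intensityL_closedBall_lt_top p.norm_le_dist3,
    M.poissonL.ae_injective p.measurable_dist3 (fun x => (norm_nonneg x).trans (p.norm_le_dist3 x))
      p.map_dist3_intensityL
      (radialDensity_le p.lamA_pos.le p.h_pos.le fun x => (p.probL_lt_one x).le)] with ω hfin hinj
  have hs : p.dist3 (M.XL (M.serving ω) ω) = M.RL ω :=
    apply_nearest (exists_eq_iInf_of_finite (d := fun i => p.dist3 (M.XL i ω))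
      (fun i => (norm_nonneg _).trans (p.norm_le_dist3 _)) hfin)
  constructor
  · rintro ⟨j, hj, h⟩
    have : j = M.serving ω := hinj (hj.trans hs.symm)
    subst this
    exact h
  · exact fun h => ⟨M.serving ω, hs, h⟩

lemma measureReal_assocL_inter_success (ef et : ℝ) :
    P.real (M.assocL ∩ M.success ef et) = ∫ r, M.covAt ef et r * p.assocDens r := by
  have h1 : P (M.assocL ∩ M.success ef et) = P (M.assocL ∩ M.link ⁻¹' p.successSet ef et) := by
    refine measure_congr ?_
    filter_upwards [M.ae_mem_success_iff ef et] with ω hω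
    exact propext (and_congr_right fun _ => hω)
  rw [Measure.real, h1, M.measure_assocL_inter_link (p.measurableSet_successSet ef et),
    integral_eq_lintegral_of_nonneg_ae]
  · congr 1
    refine lintegral_congr fun r => ?_
    rw [M.measure_prod_successSet, mul_comm (M.covAt ef et r),
      ENNReal.ofReal_mul (p.assocDens_nonneg r)]
  · refine Eventually.of_forall fun r => mul_nonneg ?_ (p.assocDens_nonneg r)
    unfold covAt
    split_ifs
    exacts [(M.covNear_mem ef et r).1, (M.covFar_mem et r).1]
  · exact ((M.measurable_covAt ef et).mul p.measurable_assocDens).aestronglyMeasurable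

lemma servDens_nonneg (i : Fin 2) (r : ℝ) : 0 ≤ M.servDens i r := by
  have hA := M.probAssocL_pos
  have hQ : 0 ≤ 1 - p.QT := by
    rw [Params.QT, sub_sub_cancel]
    exact (Real.exp_pos _).le
  fin_cases i
  · change 0 ≤ M.servDens1 r
    unfold servDens1
    split_ifs with h1
    · exact le_rfl
    all_goals
      have := p.densL_pos (not_lt.1 h1)
      have := p.voidN_pos r
      positivity
  · change 0 ≤ M.servDens2 r
    unfold servDens2
    split_ifs with h1
    · exact le_rfl
    all_goals
      have h1' := not_or.1 h1
      have hr : p.h ≤ r := not_lt.1 h1'.1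
      have := p.densL_pos hr
      have := p.voidN_pos r
      have := sub_nonneg.2 (p.one_sub_QT_le (p.h_pos.trans_le hr) (not_lt.1 h1'.2))
      positivity

/-- Each of the two nonnegative densities is dominated by their sum, which is integrable, and the
coverage factor is at most 1. -/
lemma integrableOn_mul_servDens {c : ℝ → ℝ} (hc : Measurable c) (hc1 : ∀ r, c r ∈ Icc 0 1)
    (i : Fin 2) : IntegrableOn (fun r => c r * M.servDens i r) (Ioi p.h) := by
  refine Integrable.mono' (M.integrable_assocDens.div_const M.probAssocL).integrableOn
    (hc.mul (M.measurable_servDens i)).aestronglyMeasurable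
    ((ae_restrict_iff' measurableSet_Ioi).2 (Eventually.of_forall fun r hr => ?_))
  have h0 := M.servDens_nonneg 0 r
  have h1 := M.servDens_nonneg 1 r
  rw [Real.norm_of_nonneg (mul_nonneg (hc1 r).1 (M.servDens_nonneg i r)), ← M.servDens_add hr]
  refine (mul_le_of_le_one_left (M.servDens_nonneg i r) (hc1 r).2).trans ?_
  fin_cases i
  · exact le_add_of_nonneg_right h1
  · exact le_add_of_nonneg_left h0

lemma sum_integral_mul_servDens {c : ℝ → ℝ} (hc : Measurable c) (hc1 : ∀ r, c r ∈ Icc 0 1)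
    {S : Set ℝ} (hS : MeasurableSet S) (hS' : S ⊆ Ioi p.h) :
    ∑ i : Fin 2, ∫ r in S, c r * M.servDens i r =
      (∫ r in S, c r * p.assocDens r) / M.probAssocL := by
  rw [← integral_finsetSum _ fun i _ => (M.integrableOn_mul_servDens hc hc1 i).mono_set hS',
    ← integral_div]
  refine setIntegral_congr_fun hS fun r hr => ?_
  simp only [Fin.sum_univ_two]
  rw [← mul_add, M.servDens_add (hS' hr), mul_div_assoc]

lemma integral_covAt_mul (ef et : ℝ) :
    ∫ r, M.covAt ef et r * p.assocDens r =
      (∫ r in Ioc p.h p.Rf, M.covNear ef et r * p.assocDens r) +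
        ∫ r in Ioi p.Rf, M.covFar et r * p.assocDens r := by
  have hi : Integrable fun r => M.covAt ef et r * p.assocDens r := by
    refine Integrable.mono' M.integrable_assocDens
      ((M.measurable_covAt ef et).mul p.measurable_assocDens).aestronglyMeasurable
      (Eventually.of_forall fun r => ?_)
    have hc : M.covAt ef et r ∈ Icc 0 1 := by
      unfold covAt
      split_ifs
      exacts [M.covNear_mem ef et r, M.covFar_mem et r]
    rw [Real.norm_of_nonneg (mul_nonneg hc.1 (p.assocDens_nonneg r))]
    exact mul_le_of_le_one_left (p.assocDens_nonneg r) hc.2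
  have h1 : ∫ r, M.covAt ef et r * p.assocDens r =
      ∫ r in Ioi p.h, M.covAt ef et r * p.assocDens r := by
    refine (setIntegral_eq_integral_of_forall_compl_eq_zero fun r hr => ?_).symm
    rw [Params.assocDens, if_neg (by exact hr), mul_zero]
  rw [h1, ← Ioc_union_Ioi_eq_Ioi p.h_le_Rf, setIntegral_union (Ioc_disjoint_Ioi le_rfl)
    measurableSet_Ioi hi.integrableOn hi.integrableOn]
  congr 1
  · exact setIntegral_congr_fun measurableSet_Ioc fun r hr => by
      simp only [covAt, if_pos hr.2]
  · exact setIntegral_congr_fun measurableSet_Ioi fun r hr => by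
      simp only [covAt, if_neg (not_le.2 (mem_Ioi.1 hr))]

end Network

end UAVNet

theorem theorem1 {Ω : Type*} [MeasurableSpace Ω] (P : Measure Ω) [IsProbabilityMeasure P]
    (p : UAVNet.Params) (M : UAVNet.Network p P) (ef et : ℝ) (hef : 0 < ef) (het : 0 < et) :
    (∀ i : Fin 2,
      IntegrableOn (fun r => M.covNear ef et r * M.servDens i r) (Ioc p.h p.Rf) ∧
      IntegrableOn (fun r => M.covFar et r * M.servDens i r) (Ioi p.Rf)) ∧
    0 < M.probAssocL ∧
    M.covL ef et =
      ∑ i : Fin 2,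
        ((∫ r in p.h..p.Rf, M.covNear ef et r * M.servDens i r) +
          ∫ r in Ioi p.Rf, M.covFar et r * M.servDens i r) := by
  have hn := M.measurable_covNear ef et
  have hf := M.measurable_covFar et
  have hsub1 : Ioc p.h p.Rf ⊆ Ioi p.h := Ioc_subset_Ioi_self
  have hsub2 : Ioi p.Rf ⊆ Ioi p.h := Ioi_subset_Ioi p.h_le_Rf
  refine ⟨fun i => ⟨(M.integrableOn_mul_servDens hn (M.covNear_mem ef et) i).mono_set hsub1,
    (M.integrableOn_mul_servDens hf (M.covFar_mem et) i).mono_set hsub2⟩, M.probAssocL_pos, ?_⟩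
  simp_rw [intervalIntegral.integral_of_le p.h_le_Rf]
  -- On each of the two ranges the densities are added to `assocDens` over the association
  -- probability. The near and far integrals then recombine into the probability of association
  -- together with success, and the quotient is the conditional probability.
  rw [Finset.sum_add_distrib,
    M.sum_integral_mul_servDens hn (M.covNear_mem ef et) measurableSet_Ioc hsub1,
    M.sum_integral_mul_servDens hf (M.covFar_mem et) measurableSet_Ioi hsub2, ← add_div,
    ← M.integral_covAt_mul, ← M.measureReal_assocL_inter_success, UAVNet.Network.covL,
    UAVNet.Network.probAssocL, Measure.real, cond_apply M.measurableSet_assocL, ENNReal.toReal_mul,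
    ENNReal.toReal_inv, div_eq_inv_mul]
  rfl
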